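/- Fix $2<q\le\infty$ and $\alpha>0$. For $E\subset\mathbb R^M$ let $d_q(x,E)=\inf_{y\in E}\|x-y\|_q$, with $d_q(x,\emptyset)=+\infty$, and for $\delta\in\mathbb R$ let $E_{\delta,q}=\{x\in\mathbb R^M: d_q(x,E)\le\delta\}$ be the $\ell^q$-expansion of $E$ (empty for $\delta<0$). For $Q\subset\mathbb R^N$, $E\subset\mathbb R^M$ and $A\in\mathbb R^{M\times N}$, the $\ell^q$-margin is $\mathcal M_{q,Q,E}(A)=\inf_{\sigma\in Q}d_q(A\sigma,E)$. Say that the $(A,Q,E)$-feasibility problem is satisfiable if $\mathcal M_{q,Q,E}(A)=0$ and there is $\sigma\in Q$ with $A\sigma\in E$, and unsatisfiable if $\mathcal M_{q,Q,E}(A)>0$ (and hence there is no such $\sigma$). **Theorem (sharp threshold for the margin of the generalized perceptron).** Let $M=M(N)$ be non-negative integers with $M(N)/N\to\alpha$ as $N\to\infty$ (for example $M=\lfloor\alpha N\rfloor$). For each $N$ let $Q_N$ be a non-empty subset of the closed Euclidean unit ball of $\mathbb R^N$, let $E_N\subset\mathbb R^{M(N)}$ be non-empty and invariant under all permutations of the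 coordinates, and let $A_N\in\mathbb R^{M(N)\times N}$ have independent standard normal entries. Then there is a sequence of real numbers $K_c(N)$, depending only on $q$, $(M(N))$, $(Q_N)$ and $(E_N)$, such that for every $\varepsilon>0$ and every sequence of real numbers $K(N)$: 1. if $K(N)<K_c(N)-\varepsilon$ for all sufficiently large $N$, then the $(A_N,Q_N,(E_N)_{K(N),q})$-feasibility problem is unsatisfiable with probability tending to $1$ as $N\to\infty$; 2. if $K(N)>K_c(N)+\varepsilon$ for all sufficiently large $N$, then the $(A_N,Q_N,(E_N)_{K(N),q})$-feasibility problem is satisfiable with probability tending to $1$ as $N\to\infty$. (If one of these events is not measurable, the claim is that the outer measure of its complement tends to $0$.) -/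

import Mathlib

open Filter MeasureTheory ProbabilityTheory
open scoped ENNReal Topology Matrix

noncomputable section

namespace RandomFeasibility

/-- The `ℓ^q` distance from a point `x ∈ ℝ^M` to a set `E ⊆ ℝ^M`, as an extended nonnegative real:
`inf_{y ∈ E} ‖x - y‖_q` (it is `∞` exactly when `E` is empty). -/
def lqDist (q : ℝ≥0∞) {M : ℕ} (x : Fin M → ℝ) (E : Set (Fin M → ℝ)) : ℝ≥0∞ :=
  ⨅ y ∈ E, edist (WithLp.toLp q x) (WithLp.toLp q y)

/-- The `ℓ^q`-margin of the matrix `A` with feasible set `Q` and constraint set `E`: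
`inf_{σ ∈ Q} d_q(A σ, E)`. -/
def margin (q : ℝ≥0∞) {M N : ℕ} (Q : Set (EuclideanSpace ℝ (Fin N))) (E : Set (Fin M → ℝ))
    (A : Matrix (Fin M) (Fin N) ℝ) : ℝ≥0∞ :=
  ⨅ σ ∈ Q, lqDist q (A *ᵥ σ.ofLp) E

/-- There is `σ ∈ Q` with `A σ ∈ E`. -/
def HasSolution {M N : ℕ} (Q : Set (EuclideanSpace ℝ (Fin N))) (E : Set (Fin M → ℝ))
    (A : Matrix (Fin M) (Fin N) ℝ) : Prop :=
  ∃ σ ∈ Q, A *ᵥ σ.ofLp ∈ E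

/-- The `ℓ^q`-expansion `{x : d_q(x, E) ≤ δ}`; the comparison takes place in the extended reals,
so that the expansion is empty for `δ < 0`. -/
def expansion (q : ℝ≥0∞) {M : ℕ} (E : Set (Fin M → ℝ)) (δ : ℝ) : Set (Fin M → ℝ) :=
  {x | (lqDist q x E : EReal) ≤ (δ : EReal)}

/-- Invariance of `E ⊆ ℝ^M` under all permutations of the coordinates. -/
def PermutationSymmetric {M : ℕ} (E : Set (Fin M → ℝ)) : Prop :=
  ∀ (π : Equiv.Perm (Fin M)) (x : Fin M → ℝ), x ∈ E ↔ (fun i => x (π i)) ∈ E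

/-- The random `M × N` matrix `A` on the probability space `(Ω, P)` has independent standard normal
entries. -/
def HasIndepStdNormalEntries {Ω : Type*} [MeasurableSpace Ω] {M N : ℕ}
    (A : Ω → Matrix (Fin M) (Fin N) ℝ) (P : Measure Ω) : Prop :=
  (∀ i j, HasLaw (fun ω => A ω i j) (gaussianReal 0 1) P) ∧
    iIndepFun (fun (p : Fin M × Fin N) ω => A ω p.1 p.2) P

/-- The events `S N` hold with high probability under the probabilities `P N`: the probability of the
complement tends to `0` (an outer measure where the event is not measurable). -/
def WithHighProbability {Ω : ℕ → Type*} [∀ N, MeasurableSpace (Ω N)]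
    (P : ∀ N, Measure (Ω N)) (S : ∀ N, Set (Ω N)) : Prop :=
  Tendsto (fun N => P N (S N)ᶜ) atTop (𝓝 0)

end RandomFeasibility

end

noncomputable section

namespace RandomFeasibility

/-! The threshold is `K_c(N)` = the mean of the margin `f(A)`. If `K < f(A)`, the problem for the
`K`-expansion is unsatisfiable, and if `K > f(A)` it is satisfiable (`unsatisfiable_of_lt_margin`,
`satisfiable_of_margin_lt`). By Chebyshev it therefore suffices that `Var f(A_N) → 0`. The Gaussian
Poincaré inequality gives only a bounded variance; the decay is a superconcentration phenomenon
(`exists_variance_le`) that uses just two features of `f`: it is 1-Lipschitz for the mixed norm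
`ℓ^q(ℓ²)` (with `q` lowered into `(2, 4]`), and it is invariant under permutations of the rows.

Let `p < 2` be conjugate to `q`. By duality the row norms of the gradient satisfy `∑ |∇_i f|^p ≤ 1`,
so by symmetry each row has `E|∇_i f|^r ≤ 1/M` for `r ≥ p`. Resampling row `i` then changes `f` by
at most `(π/2) M^(-1/r)` in `L^r`, for `r = p` and `r = 2` (`eLpNorm_rotate_row_le`). This is
obtained from rotations of Gaussian pairs.

Let `corr f θ` be the correlation of `f` at `X` and at `cos θ X + sin θ Z`, with `f` centred. For
`|cos θ| ≤ 1/8`, decorrelating one row at a time changes `corr` by an expectation of a product of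
two row increments. Hypercontractivity bounds it by an `L^(4/3)` norm times an `L²` norm, hence by a
constant times `M^(-1/p-1/2)`. Summing over `M` rows gives `M^(1/2-1/p) → 0` (`corr_sub_update_le`,
`corr_const_le`).

Smallness at one large angle passes to small angles by Cauchy–Schwarz, `corr(a)² ≤ E f² · corr(b)`
with `cos b = cos² a` (`corr_sq_le`). Finally `E f² ≤ corr(θ) + θ²/2` (`integral_sq_le_corr_add`),
and `θ` can be taken small before `M` is taken large. -/

/-- The standard normal distribution on the real line. -/
abbrev stdNormal : Measure ℝ := gaussianReal 0 1

/-! ### Rotation invariance of the planar Gaussian measure -/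

/-- Orthogonal linear maps of the plane preserve the standard Gaussian measure. -/
lemma measurePreserving_orthogonal {a b c d : ℝ} (h1 : a ^ 2 + b ^ 2 = 1) (h2 : c ^ 2 + d ^ 2 = 1)
    (h3 : a * c + b * d = 0) :
    MeasurePreserving (fun z : ℝ × ℝ => (a * z.1 + b * z.2, c * z.1 + d * z.2))
      (stdNormal.prod stdNormal) (stdNormal.prod stdNormal) := by
  refine ⟨by fun_prop, ?_⟩
  let R : ℝ × ℝ →L[ℝ] ℝ × ℝ :=
    ((a • ContinuousLinearMap.fst ℝ ℝ ℝ + b • ContinuousLinearMap.snd ℝ ℝ ℝ).prod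
      (c • ContinuousLinearMap.fst ℝ ℝ ℝ + d • ContinuousLinearMap.snd ℝ ℝ ℝ))
  have hR : (fun z : ℝ × ℝ => (a * z.1 + b * z.2, c * z.1 + d * z.2)) = R := by
    ext z <;> simp [R]
  -- The characteristic function depends on `L` only through the sum of squares of its coefficients,
  -- which an orthogonal map preserves.
  have key : ∀ L : StrongDual ℝ (ℝ × ℝ), charFunDual (stdNormal.prod stdNormal) L =
      Complex.exp (-((L (1, 0) ^ 2 + L (0, 1) ^ 2 : ℝ) : ℂ) / 2) := by
    intro L
    have hc : ∀ L' : StrongDual ℝ ℝ, charFunDual stdNormal L' =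
        Complex.exp (-((L' 1 ^ 2 : ℝ) : ℂ) / 2) := by
      intro L'
      have : charFunDual stdNormal L' = charFun stdNormal (L' 1) := by
        rw [charFun_eq_charFunDual_toDualMap]
        congr 1
        ext
        simp [InnerProductSpace.toDualMap_apply_apply]
      rw [this, charFun_gaussianReal]
      congr 1
      push_cast
      ring
    rw [charFunDual_prod, hc, hc, ← Complex.exp_add]
    congr 1
    simp
    ring
  rw [hR]
  have : IsProbabilityMeasure ((stdNormal.prod stdNormal).map R) :=
    Measure.isProbabilityMeasure_map (by fun_prop)
  apply Measure.ext_of_charFunDual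
  ext L
  rw [charFunDual_map, key, key]
  congr 4
  have e : ∀ x y : ℝ, L (x, y) = x * L (1, 0) + y * L (0, 1) := by
    intro x y
    have : ((x, y) : ℝ × ℝ) = x • (1, 0) + y • (0, 1) := by simp
    rw [this, map_add, map_smul, map_smul]
    simp
  simp only [R, ContinuousLinearMap.comp_apply, ContinuousLinearMap.prod_apply,
    _root_.add_apply, _root_.smul_apply, ContinuousLinearMap.coe_fst',
    ContinuousLinearMap.coe_snd', smul_eq_mul, mul_one, mul_zero, add_zero, zero_add]
  rw [e a c, e b d]
  linear_combination (L (1, 0)) ^ 2 * h1 + (L (0, 1)) ^ 2 * h2 + 2 * L (1, 0) * L (0, 1) * h3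

lemma measurePreserving_rotate_fst {a b : ℝ} (h : a ^ 2 + b ^ 2 = 1) :
    MeasurePreserving (fun z : ℝ × ℝ => a * z.1 + b * z.2) (stdNormal.prod stdNormal) stdNormal :=
  measurePreserving_fst.comp (measurePreserving_orthogonal (c := -b) (d := a) h
    (by linarith) (by ring))

/-! ### The Mehler kernel -/

section OneDim

variable {ρ s : ℝ}

/-- The variance of `s z` for standard normal `z`. -/
def sqVar (s : ℝ) : NNReal := ⟨s ^ 2, sq_nonneg s⟩

lemma coe_sqVar (s : ℝ) : (sqVar s : ℝ) = s ^ 2 := rfl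

lemma sqVar_ne_zero (hs : s ≠ 0) : sqVar s ≠ 0 := by
  intro h
  have := congrArg NNReal.toReal h
  rw [coe_sqVar] at this
  exact hs (by simpa using this)

/-- Density of `ρ x + s z`, `z` standard normal, with respect to the standard normal law. -/
def mehlerKernel (ρ s x y : ℝ) : ℝ :=
  gaussianPDFReal (ρ * x) (sqVar s) y / gaussianPDFReal 0 1 y

/-- The squared `L²` norm of `mehlerKernel ρ s x`. -/
def mehlerNormSq (ρ x : ℝ) : ℝ :=
  (√(1 - ρ ^ 4))⁻¹ * Real.exp (ρ ^ 2 * x ^ 2 / (1 + ρ ^ 2))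

/-- Writing the noise operator as an integral against a kernel makes Cauchy–Schwarz in `y`
available. -/
lemma integral_mehlerKernel (hs : s ≠ 0) (g : ℝ → ℝ) (hg : Measurable g) (x : ℝ) :
    ∫ z, g (ρ * x + s * z) ∂stdNormal = ∫ y, g y * mehlerKernel ρ s x y ∂stdNormal := by
  have hv := sqVar_ne_zero hs
  have hm : stdNormal.map (fun z => ρ * x + s * z) = gaussianReal (ρ * x) (sqVar s) := by
    have h1 : (stdNormal.map (s * ·)).map (ρ * x + ·) = gaussianReal (ρ * x) (sqVar s) := by
      rw [gaussianReal_map_const_mul, gaussianReal_map_const_add]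
      congr 1
      · ring
      · ext
        rw [NNReal.coe_mul, coe_sqVar]
        simp
    rw [← h1, Measure.map_map (by fun_prop) (by fun_prop)]
    rfl
  rw [← integral_map (φ := fun z => ρ * x + s * z) (f := g) (by fun_prop)
    hg.aestronglyMeasurable, hm, integral_gaussianReal_eq_integral_smul hv,
    integral_gaussianReal_eq_integral_smul one_ne_zero]
  congr 1
  ext y
  have := (gaussianPDFReal_pos 0 1 y one_ne_zero).ne'
  simp only [mehlerKernel, smul_eq_mul]
  field_simp

/-- Complete the square in `y`: the precision becomes `2/s² - 1 = (1 + ρ²)/s²`. What remains in `y`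
is a probability density, so the prefactor is the squared `L²` norm. -/
lemma mehlerKernel_sq_mul (h : ρ ^ 2 + s ^ 2 = 1) (hs : s ≠ 0) (x y : ℝ) :
    gaussianPDFReal 0 1 y * mehlerKernel ρ s x y ^ 2 =
      mehlerNormSq ρ x * gaussianPDFReal (2 * ρ * x / (1 + ρ ^ 2)) (sqVar (s / √(1 + ρ ^ 2))) y := by
  have hs2 : 0 < s ^ 2 := by positivity
  have hp : 0 < 1 + ρ ^ 2 := by positivity
  have hsq : √(1 + ρ ^ 2) ^ 2 = 1 + ρ ^ 2 := Real.sq_sqrt hp.le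
  have hρ : ρ ^ 2 = 1 - s ^ 2 := by linarith
  have hx : Real.exp (-(y - ρ * x) ^ 2 / (2 * s ^ 2)) ^ 2 =
      Real.exp (ρ ^ 2 * x ^ 2 / (1 + ρ ^ 2)) *
      Real.exp (-(y - 2 * ρ * x / (1 + ρ ^ 2)) ^ 2 / (2 * (s / √(1 + ρ ^ 2)) ^ 2)) *
      Real.exp (-(y - 0) ^ 2 / (2 * 1)) := by
    rw [← Real.exp_nat_mul, ← Real.exp_add, ← Real.exp_add]
    congr 1
    rw [div_pow s, hsq]
    field_simp
    have h4 : s ^ 2 = 1 - ρ ^ 2 := by linarith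
    push_cast
    rw [h4]
    ring
  have hc : (√(2 * Real.pi * s ^ 2))⁻¹ ^ 2 = (√(1 - ρ ^ 4))⁻¹ *
      (√(2 * Real.pi * (s / √(1 + ρ ^ 2)) ^ 2))⁻¹ * (√(2 * Real.pi * 1))⁻¹ := by
    rw [← mul_inv, ← mul_inv, inv_pow]
    congr 1
    have h4 : 1 - ρ ^ 4 = s ^ 2 * (1 + ρ ^ 2) := by
      have : s ^ 2 = 1 - ρ ^ 2 := by linarith
      rw [this]; ring
    rw [h4, Real.sq_sqrt (by positivity), ← Real.sqrt_mul (by positivity),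
      ← Real.sqrt_mul (by positivity), div_pow, hsq]
    symm
    rw [Real.sqrt_eq_iff_mul_self_eq (by positivity) (by positivity)]
    field_simp
  have h0 := (gaussianPDFReal_pos 0 1 y one_ne_zero).ne'
  rw [mehlerKernel, div_pow, mul_div_assoc', div_eq_iff (by positivity)]
  rw [gaussianPDFReal_def, gaussianPDFReal_def, gaussianPDFReal_def]
  simp only [coe_sqVar, mehlerNormSq, NNReal.coe_one] at *
  rw [mul_pow, hx, hc]
  ring

lemma one_le_mehlerNormSq (hρ : |ρ| ≤ 1 / 8) (x : ℝ) : 1 ≤ mehlerNormSq ρ x := by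
  have h2 : ρ ^ 2 ≤ 1 / 64 := by
    have := sq_le_sq' (by linarith [abs_nonneg ρ]) hρ
    rw [sq_abs] at this
    linarith
  have h4 : ρ ^ 4 ≤ 1 / 4096 := by nlinarith [sq_nonneg ρ]
  rw [mehlerNormSq]
  refine one_le_mul_of_one_le_of_one_le ?_ (Real.one_le_exp (by positivity))
  rw [one_le_inv₀ (Real.sqrt_pos.2 (by linarith)), Real.sqrt_le_one]
  nlinarith [sq_nonneg (ρ ^ 2)]

/-- Again a Gaussian integral: the exponential lowers the precision from `1` to `(1 - 3ρ²)/(1 +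
ρ²)`, the inverse of `w²`. The later use needs only a bound below `4/3`, so `17/16` leaves room. -/
lemma integrable_mehlerNormSq_sq (hρ : |ρ| ≤ 1 / 8) :
    Integrable (fun x => mehlerNormSq ρ x ^ 2) stdNormal ∧
      ∫ x, mehlerNormSq ρ x ^ 2 ∂stdNormal ≤ 17 / 16 := by
  have h2 : ρ ^ 2 ≤ 1 / 64 := by
    have := sq_le_sq' (by linarith [abs_nonneg ρ]) hρ
    rw [sq_abs] at this
    linarith
  have h4 : ρ ^ 4 ≤ 1 / 4096 := by nlinarith [sq_nonneg ρ]
  have hp : 0 < 1 + ρ ^ 2 := by positivity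
  have hq : 0 < 1 - 3 * ρ ^ 2 := by linarith
  have h14 : 0 < 1 - ρ ^ 4 := by linarith
  set w : ℝ := √((1 + ρ ^ 2) / (1 - 3 * ρ ^ 2)) with hw
  have hw2 : w ^ 2 = (1 + ρ ^ 2) / (1 - 3 * ρ ^ 2) := Real.sq_sqrt (by positivity)
  have hw0 : 0 < w := Real.sqrt_pos.2 (by positivity)
  have hv := sqVar_ne_zero hw0.ne'
  have key : ∀ x, gaussianPDFReal 0 1 x * mehlerNormSq ρ x ^ 2 =
      (1 - ρ ^ 4)⁻¹ * w * gaussianPDFReal 0 (sqVar w) x := by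
    intro x
    have hx : Real.exp (-(x - 0) ^ 2 / (2 * 1)) * Real.exp (ρ ^ 2 * x ^ 2 / (1 + ρ ^ 2)) ^ 2 =
        Real.exp (-(x - 0) ^ 2 / (2 * w ^ 2)) := by
      rw [← Real.exp_nat_mul, ← Real.exp_add]
      congr 1
      rw [hw2]
      push_cast
      field_simp
      ring
    have hc : (√(2 * Real.pi * 1))⁻¹ = w * (√(2 * Real.pi * w ^ 2))⁻¹ := by
      rw [Real.sqrt_mul (by positivity) (w ^ 2), Real.sqrt_sq hw0.le]
      field_simp
    rw [gaussianPDFReal_def, gaussianPDFReal_def]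
    simp only [coe_sqVar, mehlerNormSq, NNReal.coe_one]
    rw [mul_pow, ← hx, hc, inv_pow, Real.sq_sqrt h14.le]
    ring
  have hval : (1 - ρ ^ 4)⁻¹ * w ≤ 17 / 16 := by
    have hwle : w ≤ 1.034 := by
      rw [hw, Real.sqrt_le_left (by norm_num), div_le_iff₀ hq]
      nlinarith
    rw [inv_mul_le_iff₀ h14]
    nlinarith
  constructor
  · rw [stdNormal, gaussianReal_of_var_ne_zero _ one_ne_zero]
    rw [integrable_withDensity_iff_integrable_smul' (measurable_gaussianPDF 0 1)
      (ae_of_all _ fun _ => gaussianPDF_lt_top)]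
    simp only [toReal_gaussianPDF, smul_eq_mul, key]
    exact (integrable_gaussianPDFReal _ _).const_mul _
  · rw [integral_gaussianReal_eq_integral_smul one_ne_zero]
    simp only [smul_eq_mul, key]
    rw [integral_const_mul, integral_gaussianPDFReal_eq_one _ hv, mul_one]
    exact hval

end OneDim

end RandomFeasibility

/-! ### Hypercontractivity from `L²` to `L⁴` on the line -/

namespace RandomFeasibility

lemma sq_integral_mul_le {Ω : Type*} [MeasurableSpace Ω] {m : Measure Ω} {a b : Ω → ℝ}
    (ha : MemLp a 2 m) (hb : MemLp b 2 m) :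
    (∫ x, a x * b x ∂m) ^ 2 ≤ (∫ x, a x ^ 2 ∂m) * ∫ x, b x ^ 2 ∂m := by
  have hab : Integrable (fun x => a x * b x) m := ha.integrable_mul hb
  have key : ∀ t : ℝ, 0 ≤ (∫ x, b x ^ 2 ∂m) * (t * t) + (2 * ∫ x, a x * b x ∂m) * t +
      ∫ x, a x ^ 2 ∂m := by
    intro t
    have h : ∫ x, (a x + t * b x) ^ 2 ∂m = (∫ x, b x ^ 2 ∂m) * (t * t) +
        (2 * ∫ x, a x * b x ∂m) * t + ∫ x, a x ^ 2 ∂m := by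
      have e : ∀ x, (a x + t * b x) ^ 2 = (b x ^ 2 * (t * t) + a x * b x * (2 * t)) + a x ^ 2 := by
        intro x; ring
      simp_rw [e]
      rw [integral_add ?_ ha.integrable_sq,
        integral_add (hb.integrable_sq.mul_const _) (hab.mul_const _), integral_mul_const,
        integral_mul_const]
      · ring
      · exact (hb.integrable_sq.mul_const _).add (hab.mul_const _)
    rw [← h]
    exact integral_nonneg fun x => sq_nonneg _
  have := discrim_le_zero key
  rw [discrim] at this
  nlinarith

section OneDim

variable {ρ s : ℝ}

lemma measurable_mehlerKernel (x : ℝ) : Measurable (mehlerKernel ρ s x) :=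
  (measurable_gaussianPDFReal _ _).div (measurable_gaussianPDFReal _ _)

lemma memLp_mehlerKernel (h : ρ ^ 2 + s ^ 2 = 1) (hs : s ≠ 0) (x : ℝ) :
    MemLp (mehlerKernel ρ s x) 2 stdNormal ∧
      ∫ y, mehlerKernel ρ s x y ^ 2 ∂stdNormal = mehlerNormSq ρ x := by
  have hs' : sqVar (s / √(1 + ρ ^ 2)) ≠ 0 := sqVar_ne_zero (div_ne_zero hs (by positivity))
  constructor
  · rw [memLp_two_iff_integrable_sq (measurable_mehlerKernel x).aestronglyMeasurable]
    rw [stdNormal, gaussianReal_of_var_ne_zero _ one_ne_zero,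
      integrable_withDensity_iff_integrable_smul' (measurable_gaussianPDF 0 1)
      (ae_of_all _ fun _ => gaussianPDF_lt_top)]
    simp only [toReal_gaussianPDF, smul_eq_mul, mehlerKernel_sq_mul h hs]
    exact (integrable_gaussianPDFReal _ _).const_mul _
  · rw [integral_gaussianReal_eq_integral_smul one_ne_zero]
    simp only [smul_eq_mul, mehlerKernel_sq_mul h hs]
    rw [integral_const_mul, integral_gaussianPDFReal_eq_one _ hs', mul_one]

/-- The kernel has integral `1`, so the left side is the square of the integral of `(g -
mean)(kernel - 1)`, and Cauchy–Schwarz applies with `‖kernel - 1‖² = mehlerNormSq ρ x - 1`. -/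
lemma mehler_sub_mean_sq_le (h : ρ ^ 2 + s ^ 2 = 1) (hs : s ≠ 0) {g : ℝ → ℝ} (hg : Measurable g)
    (hg2 : MemLp g 2 stdNormal) (x : ℝ) :
    (∫ z, g (ρ * x + s * z) ∂stdNormal - ∫ y, g y ∂stdNormal) ^ 2 ≤
      (∫ y, (g y - ∫ y, g y ∂stdNormal) ^ 2 ∂stdNormal) * (mehlerNormSq ρ x - 1) := by
  obtain ⟨hk, hk2⟩ := memLp_mehlerKernel h hs x
  set c := ∫ y, g y ∂stdNormal with hc
  have hk1 : ∫ y, mehlerKernel ρ s x y ∂stdNormal = 1 := by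
    have := integral_mehlerKernel (ρ := ρ) hs (fun _ => 1) measurable_const x
    simpa using this.symm
  have hki : Integrable (mehlerKernel ρ s x) stdNormal := hk.integrable (by norm_num)
  have hgi : Integrable g stdNormal := hg2.integrable (by norm_num)
  have hgk : Integrable (fun y => g y * mehlerKernel ρ s x y) stdNormal := hg2.integrable_mul hk
  have e1 : ∫ y, (g y - c) * (mehlerKernel ρ s x y - 1) ∂stdNormal =
      ∫ z, g (ρ * x + s * z) ∂stdNormal - c := by
    rw [integral_mehlerKernel hs g hg]
    have e : ∀ y, (g y - c) * (mehlerKernel ρ s x y - 1) =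
        (g y * mehlerKernel ρ s x y - g y) - (mehlerKernel ρ s x y * c - c) := by
      intro y; ring
    simp_rw [e]
    rw [integral_sub ?_ ?_, integral_sub hgk hgi, integral_sub (hki.mul_const c) ?_,
      integral_mul_const, hk1]
    · simp [hc]
    · exact integrable_const c
    · exact hgk.sub hgi
    · exact (hki.mul_const c).sub (integrable_const c)
  have e2 : ∫ y, (mehlerKernel ρ s x y - 1) ^ 2 ∂stdNormal = mehlerNormSq ρ x - 1 := by
    have e : ∀ y, (mehlerKernel ρ s x y - 1) ^ 2 =
        (mehlerKernel ρ s x y ^ 2 - mehlerKernel ρ s x y * 2) + 1 := by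
      intro y; ring
    simp_rw [e]
    rw [integral_add ?_ (integrable_const _),
      integral_sub hk.integrable_sq (hki.mul_const 2), integral_mul_const, hk1, hk2]
    · simp
      ring
    · exact hk.integrable_sq.sub (hki.mul_const 2)
  rw [← e1, ← e2]
  exact sq_integral_mul_le (hg2.sub (memLp_const c)) (hk.sub (memLp_const 1))

/-- Write the smoothed function as `c + u` with `c` the mean, `u` centred and `u² ≤ v(κ - 1)`
pointwise, where `κ` is `mehlerNormSq`. In `(c + u)⁴` the term linear in `u` integrates to zero and
the others are controlled by the second moment of `κ`. The target is `(c² + v)²`. -/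
lemma mehler_four_two_real (hρ : |ρ| ≤ 1 / 8) (h : ρ ^ 2 + s ^ 2 = 1) {g : ℝ → ℝ}
    (hg : Measurable g) (hg2 : MemLp g 2 stdNormal) :
    ∫⁻ x, ENNReal.ofReal ((∫ z, g (ρ * x + s * z) ∂stdNormal) ^ 4) ∂stdNormal ≤
      ENNReal.ofReal ((∫ y, g y ^ 2 ∂stdNormal) ^ 2) := by
  have hs : s ≠ 0 := by
    rintro rfl
    have := sq_le_sq' (by linarith [abs_nonneg ρ]) hρ
    rw [sq_abs] at this
    nlinarith
  obtain ⟨hκ, hκ2⟩ := integrable_mehlerNormSq_sq hρ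
  set c := ∫ y, g y ∂stdNormal with hc
  set u : ℝ → ℝ := fun x => ∫ z, g (ρ * x + s * z) ∂stdNormal - c with hu
  set v := ∫ y, (g y - c) ^ 2 ∂stdNormal with hv
  have hv0 : 0 ≤ v := integral_nonneg fun x => sq_nonneg _
  have hgi : Integrable g stdNormal := hg2.integrable (by norm_num)
  have hgF : Integrable (fun z : ℝ × ℝ => g (ρ * z.1 + s * z.2)) (stdNormal.prod stdNormal) :=
    (measurePreserving_rotate_fst h).integrable_comp_of_integrable hgi
  have hPi : Integrable (fun x => ∫ z, g (ρ * x + s * z) ∂stdNormal) stdNormal :=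
    hgF.integral_prod_left
  have hP : ∫ x, ∫ z, g (ρ * x + s * z) ∂stdNormal ∂stdNormal = c := by
    rw [← integral_prod (fun z : ℝ × ℝ => g (ρ * z.1 + s * z.2)) hgF]
    have hmp := measurePreserving_rotate_fst h
    have := integral_map (μ := stdNormal.prod stdNormal) (f := g) hmp.aemeasurable
      hg.aestronglyMeasurable
    rw [hmp.map_eq] at this
    exact this.symm
  have hui : Integrable u stdNormal := hPi.sub (integrable_const c)
  have hu0 : ∫ x, u x ∂stdNormal = 0 := by
    rw [hu, integral_sub hPi (integrable_const c), hP]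
    simp
  have hub : ∀ x, u x ^ 2 ≤ v * (mehlerNormSq ρ x - 1) := fun x =>
    mehler_sub_mean_sq_le h hs hg hg2 x
  have hk1 := fun x => one_le_mehlerNormSq hρ x
  have hvar : ∫ y, g y ^ 2 ∂stdNormal = c ^ 2 + v := by
    have e : ∀ y, g y ^ 2 = (g y - c) ^ 2 + (g y * (2 * c) - c ^ 2) := by intro y; ring
    have hi : Integrable (fun y => (g y - c) ^ 2) stdNormal :=
      (hg2.sub (memLp_const c)).integrable_sq
    simp_rw [e]
    rw [integral_add hi ?_, integral_sub (hgi.mul_const _) (integrable_const _),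
      integral_mul_const, ← hc, ← hv]
    · simp
      ring
    · exact (hgi.mul_const _).sub (integrable_const _)
  -- From `4cu³ ≤ 2c²u² + 2u⁴` one gets `(c + u)⁴ ≤ c⁴ + 4c³u + 8c²u² + 3u⁴`; then `2u² ≤ v(κ² - 1)`
  -- and `u⁴ ≤ v²(κ² - 1)` give `B`.
  set B : ℝ → ℝ := fun x => (c ^ 4 - 4 * c ^ 2 * v - 3 * v ^ 2) + (4 * c ^ 3 * u x +
    (4 * c ^ 2 * v + 3 * v ^ 2) * mehlerNormSq ρ x ^ 2) with hB
  have hpt : ∀ x, (∫ z, g (ρ * x + s * z) ∂stdNormal) ^ 4 ≤ B x := by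
    intro x
    have e : ∫ z, g (ρ * x + s * z) ∂stdNormal = c + u x := by simp [hu]
    rw [e, hB]
    have h1 := hub x
    have h2 := hk1 x
    set k := mehlerNormSq ρ x
    have h4 : u x ^ 4 ≤ v ^ 2 * (k ^ 2 - 1) := by
      have : u x ^ 4 ≤ (v * (k - 1)) ^ 2 := by
        have := pow_le_pow_left₀ (sq_nonneg (u x)) h1 2
        calc u x ^ 4 = (u x ^ 2) ^ 2 := by ring
          _ ≤ _ := this
      nlinarith [mul_nonneg (sq_nonneg v) (sub_nonneg.2 h2)]
    have h5 : 2 * u x ^ 2 ≤ v * (k ^ 2 - 1) := by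
      nlinarith [mul_nonneg hv0 (sq_nonneg (k - 1))]
    have h6 : 4 * c * u x ^ 3 ≤ 2 * c ^ 2 * u x ^ 2 + 2 * u x ^ 4 := by
      nlinarith [mul_nonneg (sq_nonneg (u x)) (sq_nonneg (c - u x))]
    nlinarith [mul_le_mul_of_nonneg_left h5 (sq_nonneg c)]
  have hBi : Integrable B stdNormal :=
    (integrable_const _).add ((hui.const_mul _).add (hκ.const_mul _))
  have hBval : ∫ x, B x ∂stdNormal ≤ (c ^ 2 + v) ^ 2 := by
    rw [hB, integral_add (integrable_const _) ?_,
      integral_add (hui.const_mul _) (hκ.const_mul _), integral_const_mul, integral_const_mul, hu0]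
    · simp only [integral_const, probReal_univ, smul_eq_mul]
      nlinarith [mul_le_mul_of_nonneg_left hκ2 (by positivity : 0 ≤ 4 * c ^ 2 * v + 3 * v ^ 2),
        mul_nonneg (sq_nonneg c) hv0, sq_nonneg v]
    · exact (hui.const_mul _).add (hκ.const_mul _)
  calc ∫⁻ x, ENNReal.ofReal ((∫ z, g (ρ * x + s * z) ∂stdNormal) ^ 4) ∂stdNormal
      ≤ ∫⁻ x, ENNReal.ofReal (B x) ∂stdNormal :=
        lintegral_mono fun x => ENNReal.ofReal_le_ofReal (hpt x)
    _ = ENNReal.ofReal (∫ x, B x ∂stdNormal) :=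
        (ofReal_integral_eq_lintegral_ofReal hBi
          (ae_of_all _ fun x => le_trans (by positivity) (hpt x))).symm
    _ ≤ _ := by
        rw [hvar]
        exact ENNReal.ofReal_le_ofReal hBval

/-- Gaussian hypercontractivity from `L²` to `L⁴` on the line, at small correlation. -/
lemma mehler_four_two (hρ : |ρ| ≤ 1 / 8) (h : ρ ^ 2 + s ^ 2 = 1) {g : ℝ → ℝ≥0∞}
    (hg : Measurable g) :
    ∫⁻ x, (∫⁻ z, g (ρ * x + s * z) ∂stdNormal) ^ (4 : ℝ) ∂stdNormal ≤
      (∫⁻ y, g y ^ (2 : ℝ) ∂stdNormal) ^ (2 : ℝ) := by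
  by_cases htop : ∫⁻ y, g y ^ (2 : ℝ) ∂stdNormal = ∞
  · rw [htop]
    simp
  have hfin : ∀ᵐ y ∂stdNormal, g y < ∞ := by
    have := ae_lt_top (hg.pow_const _) htop
    filter_upwards [this] with y hy
    by_contra hcon
    rw [not_lt, top_le_iff] at hcon
    simp [hcon] at hy
  set r : ℝ → ℝ := fun y => (g y).toReal with hr
  have hrm : Measurable r := hg.ennreal_toReal
  have hsq : ∀ᵐ y ∂stdNormal, g y ^ (2 : ℝ) = ENNReal.ofReal (r y ^ 2) := by
    filter_upwards [hfin] with y hy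
    rw [hr, ENNReal.ofReal_pow ENNReal.toReal_nonneg, ENNReal.ofReal_toReal hy.ne]
    norm_cast
  rw [lintegral_congr_ae hsq] at htop ⊢
  have hr2 : Integrable (fun y => r y ^ 2) stdNormal := by
    refine ⟨(hrm.pow_const 2).aestronglyMeasurable, ?_⟩
    rw [hasFiniteIntegral_iff_ofReal (ae_of_all _ fun y => sq_nonneg _)]
    exact lt_top_iff_ne_top.2 htop
  have hmem : MemLp r 2 stdNormal := (memLp_two_iff_integrable_sq hrm.aestronglyMeasurable).2 hr2
  have hri : Integrable r stdNormal := hmem.integrable (by norm_num)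
  have hmp := measurePreserving_rotate_fst h
  have hF : Integrable (fun z : ℝ × ℝ => r (ρ * z.1 + s * z.2)) (stdNormal.prod stdNormal) :=
    hmp.integrable_comp_of_integrable hri
  have hae : ∀ᵐ x ∂stdNormal, (∫⁻ z, g (ρ * x + s * z) ∂stdNormal) =
      ENNReal.ofReal (∫ z, r (ρ * x + s * z) ∂stdNormal) := by
    have h1 : ∀ᵐ z ∂stdNormal.prod stdNormal, g (ρ * z.1 + s * z.2) < ∞ :=
      hmp.quasiMeasurePreserving.ae hfin
    filter_upwards [Measure.ae_ae_of_ae_prod h1, hF.prod_right_ae] with x hx hx2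
    rw [ofReal_integral_eq_lintegral_ofReal hx2 (ae_of_all _ fun z => ENNReal.toReal_nonneg)]
    refine lintegral_congr_ae ?_
    filter_upwards [hx] with z hz
    exact (ENNReal.ofReal_toReal hz.ne).symm
  calc ∫⁻ x, (∫⁻ z, g (ρ * x + s * z) ∂stdNormal) ^ (4 : ℝ) ∂stdNormal
      = ∫⁻ x, ENNReal.ofReal ((∫ z, r (ρ * x + s * z) ∂stdNormal) ^ 4) ∂stdNormal := by
        refine lintegral_congr_ae ?_
        filter_upwards [hae] with x hx
        rw [hx, ENNReal.ofReal_pow (integral_nonneg fun z => ENNReal.toReal_nonneg)]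
        norm_cast
    _ ≤ ENNReal.ofReal ((∫ y, r y ^ 2 ∂stdNormal) ^ 2) := mehler_four_two_real hρ h hrm hmem
    _ = _ := by
        rw [← ofReal_integral_eq_lintegral_ofReal hr2 (ae_of_all _ fun y => sq_nonneg _),
          ENNReal.ofReal_pow (integral_nonneg fun y => sq_nonneg _)]
        norm_cast

end OneDim

/-! ### Tensorised two-function hypercontractivity -/

/-- Two-function hypercontractive inequality for the pair of random variables `(X, Y)` under `m`. -/
def Hypercontractive {Ω α β : Type*} [MeasurableSpace Ω] [MeasurableSpace α] [MeasurableSpace β]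
    (m : Measure Ω) (X : Ω → α) (Y : Ω → β) : Prop :=
  ∀ (h : α → ℝ≥0∞) (g : β → ℝ≥0∞), Measurable h → Measurable g →
    ∫⁻ ω, h (X ω) * g (Y ω) ∂m ≤
      (∫⁻ ω, h (X ω) ^ (4 / 3 : ℝ) ∂m) ^ (3 / 4 : ℝ) * (∫⁻ ω, g (Y ω) ^ (2 : ℝ) ∂m) ^ (1 / 2 : ℝ)

namespace Hypercontractive

variable {Ω Ω' α β α' β' : Type*} [MeasurableSpace Ω] [MeasurableSpace Ω'] [MeasurableSpace α]
  [MeasurableSpace β] [MeasurableSpace α'] [MeasurableSpace β'] {m : Measure Ω} {m' : Measure Ω'}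

lemma comp {X : Ω → α} {Y : Ω → β} (H : Hypercontractive m X Y) {T : Ω' → Ω}
    (hT : MeasurePreserving T m' m) (hX : Measurable X) (hY : Measurable Y) :
    Hypercontractive m' (X ∘ T) (Y ∘ T) := by
  intro h g hh hg
  have := H h g hh hg
  rw [← hT.lintegral_comp (by fun_prop), ← hT.lintegral_comp (by fun_prop),
    ← hT.lintegral_comp (by fun_prop)] at this
  exact this

lemma postcomp {X : Ω → α} {Y : Ω → β} (H : Hypercontractive m X Y) {u : α → α'} {v : β → β'}
    (hu : Measurable u) (hv : Measurable v) : Hypercontractive m (u ∘ X) (v ∘ Y) :=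
  fun h g hh hg => H (h ∘ u) (g ∘ v) (hh.comp hu) (hg.comp hv)

lemma of_unit [IsProbabilityMeasure m] [Subsingleton α] [Subsingleton β] (X : Ω → α) (Y : Ω → β) :
    Hypercontractive m X Y := by
  intro h g _ _
  by_cases hΩ : Nonempty Ω
  · obtain ⟨ω₀⟩ := hΩ
    have e1 : ∀ ω, X ω = X ω₀ := fun ω => Subsingleton.elim _ _
    have e2 : ∀ ω, Y ω = Y ω₀ := fun ω => Subsingleton.elim _ _
    simp_rw [e1, e2]
    simp only [lintegral_const, measure_univ, mul_one]
    rw [← ENNReal.rpow_mul, ← ENNReal.rpow_mul]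
    norm_num
  · rw [not_nonempty_iff] at hΩ
    simp [Measure.eq_zero_of_isEmpty m]

/-- Apply the inner inequality with the outer variable frozen, then the outer one to the partial
norms. No constant accumulates because the inequality has constant `1`. -/
lemma prod [SFinite m] [SFinite m'] {X : Ω → α} {Y : Ω → β} {X' : Ω' → α'} {Y' : Ω' → β'}
    (H : Hypercontractive m X Y) (H' : Hypercontractive m' X' Y') (hX : Measurable X)
    (hY : Measurable Y) (hX' : Measurable X') (hY' : Measurable Y') :
    Hypercontractive (m.prod m') (Prod.map X X') (Prod.map Y Y') := by
  intro h g hh hg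
  have hh' : Measurable fun a => (∫⁻ ω', h (a, X' ω') ^ (4 / 3 : ℝ) ∂m') ^ (3 / 4 : ℝ) :=
    Measurable.pow_const (Measurable.lintegral_prod_right' (f := fun z : α × Ω' =>
      h (z.1, X' z.2) ^ (4 / 3 : ℝ)) (by fun_prop)) _
  have hg' : Measurable fun b => (∫⁻ ω', g (b, Y' ω') ^ (2 : ℝ) ∂m') ^ (1 / 2 : ℝ) :=
    Measurable.pow_const (Measurable.lintegral_prod_right' (f := fun z : β × Ω' =>
      g (z.1, Y' z.2) ^ (2 : ℝ)) (by fun_prop)) _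
  rw [lintegral_prod _ (by fun_prop), lintegral_prod _ (by fun_prop), lintegral_prod _ (by fun_prop)]
  calc ∫⁻ ω, ∫⁻ ω', h (X ω, X' ω') * g (Y ω, Y' ω') ∂m' ∂m
      ≤ ∫⁻ ω, (∫⁻ ω', h (X ω, X' ω') ^ (4 / 3 : ℝ) ∂m') ^ (3 / 4 : ℝ) *
          (∫⁻ ω', g (Y ω, Y' ω') ^ (2 : ℝ) ∂m') ^ (1 / 2 : ℝ) ∂m :=
        lintegral_mono fun ω => H' (fun a => h (X ω, a)) (fun b => g (Y ω, b)) (by fun_prop)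
          (by fun_prop)
    _ ≤ _ := H _ _ hh' hg'
    _ = _ := by
        simp only [← ENNReal.rpow_mul, Prod.map_apply]
        norm_num

lemma _root_.RandomFeasibility.lintegral_le_rpow (n : Measure Ω) [IsProbabilityMeasure n]
    {f : Ω → ℝ≥0∞} {p : ℝ} (hf : Measurable f) (hp : 1 ≤ p) :
    ∫⁻ x, f x ∂n ≤ (∫⁻ x, f x ^ p ∂n) ^ (1 / p) := by
  have := eLpNorm'_le_eLpNorm'_of_exponent_le (μ := n) (f := f) zero_lt_one hp
    hf.aestronglyMeasurable
  simpa [eLpNorm'_eq_lintegral_enorm] using this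

/-- The expectation factorises, and `L¹` norms are dominated by `L^(4/3)` and `L²` norms under a
probability measure. -/
lemma of_indep [IsProbabilityMeasure m] [IsProbabilityMeasure m'] {X : Ω → α} {Y : Ω' → β}
    (hX : Measurable X) (hY : Measurable Y) :
    Hypercontractive (m.prod m') (fun z => X z.1) (fun z => Y z.2) := by
  intro h g hh hg
  rw [lintegral_prod_mul (f := fun x => h (X x)) (g := fun y => g (Y y)) (by fun_prop)
    (by fun_prop)]
  have e1 : ∫⁻ z, h (X z.1) ^ (4 / 3 : ℝ) ∂m.prod m' = ∫⁻ x, h (X x) ^ (4 / 3 : ℝ) ∂m :=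
    measurePreserving_fst.lintegral_comp (f := fun x => h (X x) ^ (4 / 3 : ℝ)) (by fun_prop)
  have e2 : ∫⁻ z, g (Y z.2) ^ (2 : ℝ) ∂m.prod m' = ∫⁻ y, g (Y y) ^ (2 : ℝ) ∂m' :=
    measurePreserving_snd.lintegral_comp (f := fun y => g (Y y) ^ (2 : ℝ)) (by fun_prop)
  rw [e1, e2]
  have h1 := lintegral_le_rpow m (f := fun x => h (X x)) (p := 4 / 3) (by fun_prop) (by norm_num)
  have h2 := lintegral_le_rpow m' (f := fun x => g (Y x)) (p := 2) (by fun_prop) (by norm_num)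
  norm_num at h1
  exact mul_le_mul' h1 h2

/-- Hölder with the conjugate pair `4/3`, `4`, followed by `mehler_four_two`. -/
lemma rotate {ρ s : ℝ} (hρ : |ρ| ≤ 1 / 8) (h : ρ ^ 2 + s ^ 2 = 1) :
    Hypercontractive (stdNormal.prod stdNormal) Prod.fst (fun z => ρ * z.1 + s * z.2) := by
  intro f g hf hg
  have e1 : ∫⁻ z, f z.1 ^ (4 / 3 : ℝ) ∂stdNormal.prod stdNormal =
      ∫⁻ x, f x ^ (4 / 3 : ℝ) ∂stdNormal :=
    measurePreserving_fst.lintegral_comp (f := fun x => f x ^ (4 / 3 : ℝ)) (by fun_prop)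
  have e2 : ∫⁻ z, g (ρ * z.1 + s * z.2) ^ (2 : ℝ) ∂stdNormal.prod stdNormal =
      ∫⁻ y, g y ^ (2 : ℝ) ∂stdNormal :=
    (measurePreserving_rotate_fst h).lintegral_comp (f := fun y => g y ^ (2 : ℝ)) (by fun_prop)
  rw [e1, e2, lintegral_prod _ (by fun_prop)]
  have hP : Measurable fun x => ∫⁻ z, g (ρ * x + s * z) ∂stdNormal :=
    Measurable.lintegral_prod_right' (f := fun z : ℝ × ℝ => g (ρ * z.1 + s * z.2)) (by fun_prop)
  calc ∫⁻ x, ∫⁻ z, f x * g (ρ * x + s * z) ∂stdNormal ∂stdNormal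
      = ∫⁻ x, f x * ∫⁻ z, g (ρ * x + s * z) ∂stdNormal ∂stdNormal :=
        lintegral_congr fun x => lintegral_const_mul _ (by fun_prop)
    _ ≤ (∫⁻ x, f x ^ (4 / 3 : ℝ) ∂stdNormal) ^ (1 / (4 / 3) : ℝ) *
        (∫⁻ x, (∫⁻ z, g (ρ * x + s * z) ∂stdNormal) ^ (4 : ℝ) ∂stdNormal) ^ (1 / 4 : ℝ) :=
        ENNReal.lintegral_mul_le_Lp_mul_Lq _ (Real.holderConjugate_iff.2 (by norm_num))
          hf.aemeasurable hP.aemeasurable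
    _ ≤ _ := by
        have := ENNReal.rpow_le_rpow (mehler_four_two hρ h hg) (by norm_num : (0 : ℝ) ≤ 1 / 4)
        rw [← ENNReal.rpow_mul] at this
        norm_num at this ⊢
        gcongr

lemma pi {n : ℕ} {Ω α β : Type*} [MeasurableSpace Ω] [MeasurableSpace α] [MeasurableSpace β]
    {m : Measure Ω} [IsProbabilityMeasure m] {X : Fin n → Ω → α} {Y : Fin n → Ω → β}
    (H : ∀ i, Hypercontractive m (X i) (Y i)) (hX : ∀ i, Measurable (X i))
    (hY : ∀ i, Measurable (Y i)) :
    Hypercontractive (Measure.pi fun _ : Fin n => m) (fun ω i => X i (ω i))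
      (fun ω i => Y i (ω i)) := by
  induction n with
  | zero => exact of_unit _ _
  | succ n ih =>
    have hT := measurePreserving_piFinSuccAbove (fun _ : Fin (n + 1) => m) 0
    have IH := ih (fun i => H i.succ) (fun i => hX i.succ) (fun i => hY i.succ)
    have hXm : Measurable fun (ω : Fin n → Ω) i => X i.succ (ω i) :=
      measurable_pi_lambda _ fun i => (hX i.succ).comp (measurable_pi_apply i)
    have hYm : Measurable fun (ω : Fin n → Ω) i => Y i.succ (ω i) :=
      measurable_pi_lambda _ fun i => (hY i.succ).comp (measurable_pi_apply i)
    have := (((H 0).prod IH (hX 0) (hY 0) hXm hYm).comp hT (by fun_prop) (by fun_prop)).postcomp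
      (MeasurableEquiv.piFinSuccAbove (fun _ => α) 0).symm.measurable
      (MeasurableEquiv.piFinSuccAbove (fun _ => β) 0).symm.measurable
    convert this using 1
    · ext ω i
      refine Fin.cases ?_ (fun i => ?_) i <;>
        simp [MeasurableEquiv.piFinSuccAbove, Fin.insertNthEquiv] <;> rfl
    · ext ω i
      refine Fin.cases ?_ (fun i => ?_) i <;>
        simp [MeasurableEquiv.piFinSuccAbove, Fin.insertNthEquiv] <;> rfl

end Hypercontractive

end RandomFeasibility

/-! ### Rotations of Gaussian matrices and increments of Lipschitz functions -/

namespace RandomFeasibility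

lemma isGaussian_pi {n : ℕ} {F : Type*} [NormedAddCommGroup F] [NormedSpace ℝ F] [MeasurableSpace F]
    [BorelSpace F] [SecondCountableTopology F] [CompleteSpace F] (m : Measure F) [IsGaussian m] :
    IsGaussian (Measure.pi fun _ : Fin n => m) := by
  have h := (iIndepFun_pi (μ := fun _ : Fin n => m) (X := fun _ x => x)
    (fun _ => aemeasurable_id))
  have hX : ∀ i : Fin n, HasGaussianLaw (fun ω : Fin n → F => ω i) (Measure.pi fun _ : Fin n => m) := by
    intro i
    refine ⟨?_⟩
    have h1 := (measurePreserving_eval (fun _ : Fin n => m) i).map_eq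
    have h2 : (fun ω : Fin n → F => ω i) = Function.eval i := rfl
    rw [h2, h1]
    infer_instance
  have := (h.hasGaussianLaw hX).isGaussian_map
  simpa using this

lemma absolutelyContinuous_pi {n : ℕ} {α : Type*} [MeasurableSpace α] {m m' : Measure α}
    [SigmaFinite m] [SigmaFinite m'] (h : m ≪ m') :
    (Measure.pi fun _ : Fin n => m) ≪ Measure.pi fun _ : Fin n => m' := by
  induction n with
  | zero =>
    rw [Measure.pi_of_empty, Measure.pi_of_empty]
  | succ n ih =>
    have h1 := (measurePreserving_piFinSuccAbove (fun _ : Fin (n + 1) => m) 0).symm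
    have h2 := (measurePreserving_piFinSuccAbove (fun _ : Fin (n + 1) => m') 0).symm
    rw [← h1.map_eq, ← h2.map_eq]
    exact (h.prod ih).map (MeasurableEquiv.measurable _)

section Setup

variable (M N : ℕ)

/-- The law of an `M × N` matrix with independent standard normal entries. -/
abbrev gaussMat : Measure (Fin M → Fin N → ℝ) :=
  Measure.pi fun _ => Measure.pi fun _ => stdNormal

/-- The law of an entrywise pair of independent standard Gaussian matrices. -/
abbrev gaussPair : Measure (Fin M → Fin N → ℝ × ℝ) :=
  Measure.pi fun _ => Measure.pi fun _ => stdNormal.prod stdNormal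

instance : IsGaussian (gaussMat M N) :=
  have := isGaussian_pi (n := N) stdNormal
  isGaussian_pi _

instance : IsGaussian (gaussPair M N) :=
  have := isGaussian_pi (n := N) (stdNormal.prod stdNormal)
  isGaussian_pi _

/-- This transfers Rademacher's theorem from Lebesgue measure to the Gaussian law. -/
lemma gaussMat_absolutelyContinuous : gaussMat M N ≪ volume :=
  absolutelyContinuous_pi (absolutelyContinuous_pi
    (gaussianReal_absolutelyContinuous 0 one_ne_zero))

end Setup

variable {M N : ℕ}

/-- The two matrices of an entrywise pair, combined with angle `t i` in row `i`. -/
def mix (t : Fin M → ℝ) (ω : Fin M → Fin N → ℝ × ℝ) : Fin M → Fin N → ℝ := fun i j =>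
  Real.cos (t i) * (ω i j).1 + Real.sin (t i) * (ω i j).2

/-- Rotation by the angle `t i` in row `i`. -/
def turn (t : Fin M → ℝ) (ω : Fin M → Fin N → ℝ × ℝ) : Fin M → Fin N → ℝ × ℝ := fun i j =>
  (Real.cos (t i) * (ω i j).1 + Real.sin (t i) * (ω i j).2,
    -Real.sin (t i) * (ω i j).1 + Real.cos (t i) * (ω i j).2)

lemma measurePreserving_mix (t : Fin M → ℝ) :
    MeasurePreserving (mix (N := N) t) (gaussPair M N) (gaussMat M N) :=
  measurePreserving_pi _ _ (f := fun i (r : Fin N → ℝ × ℝ) j =>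
      Real.cos (t i) * (r j).1 + Real.sin (t i) * (r j).2)
    fun _ => measurePreserving_pi _ _ fun _ =>
      measurePreserving_rotate_fst (Real.cos_sq_add_sin_sq _)

lemma measurePreserving_turn (t : Fin M → ℝ) :
    MeasurePreserving (turn (N := N) t) (gaussPair M N) (gaussPair M N) :=
  measurePreserving_pi _ _ (f := fun i (r : Fin N → ℝ × ℝ) j =>
      (Real.cos (t i) * (r j).1 + Real.sin (t i) * (r j).2,
        -Real.sin (t i) * (r j).1 + Real.cos (t i) * (r j).2))
    fun i => measurePreserving_pi _ _ fun _ =>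
      measurePreserving_orthogonal (Real.cos_sq_add_sin_sq _)
        (by rw [neg_sq]; exact Real.sin_sq_add_cos_sq _) (by ring)

/-- Angles add. With the invariance of the law under `turn`, this makes the increments of `f` along
a rotation stationary. -/
lemma mix_turn (s t : Fin M → ℝ) (ω : Fin M → Fin N → ℝ × ℝ) :
    mix s (turn t ω) = mix (t + s) ω := by
  ext i j
  simp only [mix, turn, Pi.add_apply, Real.cos_add, Real.sin_add]
  ring

lemma mix_zero (ω : Fin M → Fin N → ℝ × ℝ) : mix 0 ω = fun i j => (ω i j).1 := by
  ext i j
  simp [mix]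

lemma abs_mix_sub_le (t : Fin M → ℝ) (ω : Fin M → Fin N → ℝ × ℝ) :
    ‖mix 0 ω - mix t ω‖ ≤ 2 * ‖t‖ * ‖ω‖ := by
  rw [pi_norm_le_iff_of_nonneg (by positivity)]
  intro i
  rw [pi_norm_le_iff_of_nonneg (by positivity)]
  intro j
  have h1 : ‖ω i j‖ ≤ ‖ω‖ := (norm_le_pi_norm (ω i) j).trans (norm_le_pi_norm ω i)
  have h2 : |(ω i j).1| ≤ ‖ω‖ := (norm_fst_le (ω i j)).trans h1
  have h3 : |(ω i j).2| ≤ ‖ω‖ := (norm_snd_le (ω i j)).trans h1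
  have h4 : |t i| ≤ ‖t‖ := norm_le_pi_norm t i
  have h5 : |Real.sin (t i)| ≤ ‖t‖ := Real.abs_sin_le_abs.trans h4
  have h6 : |Real.cos 0 - Real.cos (t i)| ≤ ‖t‖ :=
    (Real.abs_cos_sub_cos_le _ _).trans (by simpa using h4)
  rw [Real.cos_zero] at h6
  have e : (mix 0 ω - mix t ω) i j =
      (1 - Real.cos (t i)) * (ω i j).1 - Real.sin (t i) * (ω i j).2 := by
    simp [mix]
    ring
  rw [e, Real.norm_eq_abs]
  calc _ ≤ |(1 - Real.cos (t i)) * (ω i j).1| + |Real.sin (t i) * (ω i j).2| := abs_sub _ _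
    _ ≤ ‖t‖ * ‖ω‖ + ‖t‖ * ‖ω‖ := by
      rw [abs_mul, abs_mul]
      gcongr
    _ = _ := by ring

lemma hasDerivAt_mix (m : Fin M → ℝ) (ω : Fin M → Fin N → ℝ × ℝ) :
    HasDerivAt (fun τ : ℝ => mix (τ • m) ω) (fun i j => m i * (ω i j).2) 0 := by
  rw [hasDerivAt_pi]
  intro i
  rw [hasDerivAt_pi]
  intro j
  have h : HasDerivAt (fun τ : ℝ => τ * m i) (m i) 0 := by
    simpa using (hasDerivAt_id (0 : ℝ)).mul_const (m i)
  have := (h.cos.mul_const (ω i j).1).fun_add (h.sin.mul_const (ω i j).2)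
  simpa [mix] using this

lemma memLp_lipschitz {E : Type*} [NormedAddCommGroup E] [NormedSpace ℝ E] [CompleteSpace E]
    [MeasurableSpace E] [BorelSpace E] [SecondCountableTopology E] {m : Measure E} [IsGaussian m]
    {f : E → ℝ} {K : NNReal} (hf : LipschitzWith K f) {p : ℝ≥0∞} (hp : p ≠ ∞) :
    MemLp f p m := by
  have hc : MemLp (fun _ : E => |f 0|) p m := memLp_const _
  have hn : MemLp (fun x : E => ‖x‖) p m := (IsGaussian.memLp_id m p hp).norm
  have h1 : MemLp (fun x => |f 0| + K * ‖x‖) p m := hc.add (hn.const_mul (K : ℝ))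
  refine h1.mono hf.continuous.aestronglyMeasurable (ae_of_all _ fun x => ?_)
  have h2 := hf.dist_le_mul x 0
  rw [Real.dist_eq, dist_zero_right] at h2
  rw [Real.norm_eq_abs, Real.norm_eq_abs]
  refine le_trans ?_ (le_abs_self _)
  have := abs_sub_abs_le_abs_sub (f x) (f 0)
  linarith

/-- Cut the rotation into `n` equal steps. By stationarity all increments have the same norm, so the
triangle inequality gives `n` times the norm of one step of angle `θ/n`; as `n → ∞` this tends to
the norm of a derivative, by Rademacher and dominated convergence. -/
lemma eLpNorm_mix_sub_le {f : (Fin M → Fin N → ℝ) → ℝ} {K : NNReal} (hf : LipschitzWith K f)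
    (m : Fin M → ℝ) (θ : ℝ) {p : ℝ≥0∞} (hp : 1 ≤ p) (hp' : p ≠ ∞) :
    eLpNorm (fun ω => f (mix 0 ω) - f (mix (θ • m) ω)) p (gaussPair M N) ≤
      ENNReal.ofReal |θ| * eLpNorm (fun ω => fderiv ℝ f (mix 0 ω) (fun i j => m i * (ω i j).2)) p
        (gaussPair M N) := by
  -- The slope limit below is taken along `θ / n`, which has to be nonzero.
  by_cases hθ : θ = 0
  · simp [hθ]
  have hfm : ∀ t : Fin M → ℝ, Measurable fun ω : Fin M → Fin N → ℝ × ℝ => f (mix t ω) := fun t =>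
    hf.continuous.measurable.comp (measurePreserving_mix t).measurable
  have hfs := fun t : Fin M → ℝ => (hfm t).aestronglyMeasurable (μ := gaussPair M N)
  set F : ℕ → (Fin M → Fin N → ℝ × ℝ) → ℝ := fun n ω =>
    n * (f (mix 0 ω) - f (mix ((θ / n) • m) ω)) with hF
  set G : (Fin M → Fin N → ℝ × ℝ) → ℝ := fun ω =>
    -θ * fderiv ℝ f (mix 0 ω) (fun i j => m i * (ω i j).2) with hG
  have hle : ∀ n : ℕ, n ≠ 0 →
      eLpNorm (fun ω => f (mix 0 ω) - f (mix (θ • m) ω)) p (gaussPair M N) ≤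
        eLpNorm (F n) p (gaussPair M N) := by
    intro n hn
    set δ := θ / n with hδ
    have hn' : (n : ℝ) ≠ 0 := Nat.cast_ne_zero.2 hn
    have htel : (fun ω => f (mix 0 ω) - f (mix (θ • m) ω)) =
        ∑ k ∈ Finset.range n, fun ω : Fin M → Fin N → ℝ × ℝ =>
          f (mix ((k * δ) • m) ω) - f (mix (((k + 1 : ℕ) * δ) • m) ω) := by
      ext ω
      rw [Finset.sum_apply, Finset.sum_range_sub' (fun k : ℕ => f (mix ((k * δ) • m) ω))]
      congr 4
      · simp
      · rw [hδ]; field_simp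
    have hstep : ∀ k : ℕ, eLpNorm (fun ω : Fin M → Fin N → ℝ × ℝ =>
        f (mix ((k * δ) • m) ω) - f (mix (((k + 1 : ℕ) * δ) • m) ω)) p (gaussPair M N) =
        eLpNorm (fun ω => f (mix 0 ω) - f (mix (δ • m) ω)) p (gaussPair M N) := by
      intro k
      refine Eq.trans ?_ (eLpNorm_comp_measurePreserving (p := p) ((hfs 0).sub (hfs (δ • m)))
        (measurePreserving_turn (((k : ℝ) * δ) • m)))
      congr 1
      ext ω
      simp only [Function.comp_apply, mix_turn, add_zero]
      congr 4
      push_cast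
      rw [add_mul, add_smul, one_mul]
    calc _ ≤ ∑ k ∈ Finset.range n, eLpNorm (fun ω : Fin M → Fin N → ℝ × ℝ =>
          f (mix ((k * δ) • m) ω) - f (mix (((k + 1 : ℕ) * δ) • m) ω)) p (gaussPair M N) := by
          rw [htel]
          exact eLpNorm_sum_le (fun k _ => (hfs _).sub (hfs _)) hp
      _ = eLpNorm (F n) p (gaussPair M N) := by
          simp_rw [hstep]
          rw [Finset.sum_const, Finset.card_range]
          have := eLpNorm_const_smul (μ := gaussPair M N) (p := p) (n : ℝ)
            (fun ω => f (mix 0 ω) - f (mix (δ • m) ω))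
          rw [show F n = (n : ℝ) • fun ω => f (mix 0 ω) - f (mix (δ • m) ω) from rfl, this]
          simp
  have hlim : ∀ᵐ ω ∂gaussPair M N, Tendsto (fun n => F n ω) atTop (𝓝 (G ω)) := by
    have h1 : ∀ᵐ x ∂gaussMat M N, DifferentiableAt ℝ f x :=
      (gaussMat_absolutelyContinuous M N).ae_le hf.ae_differentiableAt
    have h2 := (measurePreserving_mix (0 : Fin M → ℝ)).quasiMeasurePreserving.ae h1
    filter_upwards [h2] with ω hω
    have h3 : HasFDerivAt f (fderiv ℝ f (mix 0 ω)) (mix ((0 : ℝ) • m) ω) := by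
      rw [zero_smul]; exact hω.hasFDerivAt
    have h4 := (h3.comp_hasDerivAt 0 (hasDerivAt_mix m ω)).tendsto_slope_zero
    have h5 : Tendsto (fun n : ℕ => θ / n) atTop (𝓝[≠] 0) := by
      rw [tendsto_nhdsWithin_iff]
      refine ⟨tendsto_const_div_atTop_nhds_zero_nat θ, ?_⟩
      filter_upwards [eventually_gt_atTop 0] with n hn
      exact div_ne_zero hθ (Nat.cast_ne_zero.2 hn.ne')
    refine ((h4.comp h5).const_mul (-θ)).congr' ?_
    filter_upwards [eventually_gt_atTop 0] with n hn
    have hn' : (n : ℝ) ≠ 0 := Nat.cast_ne_zero.2 hn.ne'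
    simp only [hF, Function.comp_apply, zero_add, zero_smul, smul_eq_mul]
    field_simp
    ring
  -- The Lipschitz bound gives a dominating function independent of `n`: a multiple of `‖ω‖`, which
  -- has Gaussian moments of every order.
  have hbound : ∀ n ω, ‖F n ω‖ ≤ (K * (2 * |θ| * ‖m‖)) * ‖ω‖ := by
    intro n ω
    by_cases hn : n = 0
    · simp only [hF, hn, Nat.cast_zero, zero_mul, norm_zero]
      positivity
    have hn' : (0 : ℝ) < n := Nat.cast_pos.2 (Nat.pos_of_ne_zero hn)
    have h1 := hf.dist_le_mul (mix 0 ω) (mix ((θ / n) • m) ω)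
    rw [dist_eq_norm, dist_eq_norm] at h1
    have h2 := abs_mix_sub_le ((θ / n) • m) ω
    rw [norm_smul, Real.norm_eq_abs, abs_div, abs_of_pos hn'] at h2
    rw [hF, norm_mul, Real.norm_of_nonneg hn'.le]
    calc (n : ℝ) * ‖f (mix 0 ω) - f (mix ((θ / n) • m) ω)‖
        ≤ n * (K * (2 * (|θ| / n * ‖m‖) * ‖ω‖)) := by gcongr; exact h1.trans (by gcongr)
      _ = _ := by field_simp
  have hp0 : p ≠ 0 := (zero_lt_one.trans_le hp).ne'
  have hpr : 0 ≤ p.toReal := ENNReal.toReal_nonneg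
  have htend : Tendsto (fun n => eLpNorm (F n) p (gaussPair M N)) atTop
      (𝓝 (eLpNorm G p (gaussPair M N))) := by
    simp_rw [eLpNorm_eq_lintegral_rpow_enorm_toReal hp0 hp']
    refine (ENNReal.continuous_rpow_const.tendsto _).comp ?_
    refine tendsto_lintegral_of_dominated_convergence
      (fun ω => ‖(K * (2 * |θ| * ‖m‖)) * ‖ω‖‖ₑ ^ p.toReal) ?_ ?_ ?_ ?_
    · intro n
      exact ((((hfm 0).sub (hfm _)).const_mul _).enorm).pow_const _
    · intro n
      refine ae_of_all _ fun ω => ?_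
      refine ENNReal.rpow_le_rpow ?_ hpr
      rw [enorm_le_iff_norm_le]
      exact (hbound n ω).trans (le_abs_self _)
    · have := ((IsGaussian.memLp_id (gaussPair M N) p hp').norm.const_mul
        (K * (2 * |θ| * ‖m‖))).eLpNorm_lt_top
      exact (lintegral_rpow_enorm_lt_top_of_eLpNorm_lt_top hp0 hp' this).ne
    · filter_upwards [hlim] with ω hω
      exact (ENNReal.continuous_rpow_const.tendsto _).comp ((continuous_enorm.tendsto _).comp hω)
  have h1 := ge_of_tendsto htend (eventually_atTop.2 ⟨1, fun n hn => hle n (by omega)⟩)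
  refine h1.trans (le_of_eq ?_)
  have := eLpNorm_const_smul (μ := gaussPair M N) (p := p) (-θ)
    (fun ω => fderiv ℝ f (mix 0 ω) (fun i j => m i * (ω i j).2))
  rw [show G = (-θ) • fun ω => fderiv ℝ f (mix 0 ω) (fun i j => m i * (ω i j).2) from rfl, this,
    enorm_neg, Real.enorm_eq_ofReal_abs]

end RandomFeasibility

/-! ### The mixed norm, its dual, and the rows of the gradient -/

namespace RandomFeasibility

variable {M N : ℕ}

/-- The Euclidean norm of the `i`-th row. -/
def rowNorm (x : Fin M → Fin N → ℝ) (i : Fin M) : ℝ := √(∑ j, x i j ^ 2)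

/-- The mixed `ℓ^q(ℓ²)` norm of a matrix. -/
def mixedNorm (q : ℝ) (x : Fin M → Fin N → ℝ) : ℝ := (∑ i, rowNorm x i ^ q) ^ (1 / q)

lemma rowNorm_nonneg (x : Fin M → Fin N → ℝ) (i : Fin M) : 0 ≤ rowNorm x i := Real.sqrt_nonneg _

lemma rowNorm_sq (x : Fin M → Fin N → ℝ) (i : Fin M) : rowNorm x i ^ 2 = ∑ j, x i j ^ 2 :=
  Real.sq_sqrt (Finset.sum_nonneg fun _ _ => sq_nonneg _)

lemma mixedNorm_nonneg (q : ℝ) (x : Fin M → Fin N → ℝ) : 0 ≤ mixedNorm q x :=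
  Real.rpow_nonneg (Finset.sum_nonneg fun i _ => Real.rpow_nonneg (rowNorm_nonneg x i) _) _

lemma mixedNorm_smul {q : ℝ} (hq : 0 < q) (t : ℝ) (x : Fin M → Fin N → ℝ) :
    mixedNorm q (t • x) = |t| * mixedNorm q x := by
  have h1 : ∀ i, rowNorm (t • x) i = |t| * rowNorm x i := by
    intro i
    simp only [rowNorm, Pi.smul_apply, smul_eq_mul, mul_pow]
    rw [← Finset.mul_sum, Real.sqrt_mul (sq_nonneg t), Real.sqrt_sq_eq_abs]
  simp only [mixedNorm, h1]
  simp_rw [Real.mul_rpow (abs_nonneg t) (rowNorm_nonneg x _)]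
  rw [← Finset.mul_sum, Real.mul_rpow (Real.rpow_nonneg (abs_nonneg t) _)
    (Finset.sum_nonneg fun i _ => Real.rpow_nonneg (rowNorm_nonneg x i) _),
    ← Real.rpow_mul (abs_nonneg t), mul_one_div_cancel hq.ne', Real.rpow_one]

lemma mixedNorm_le {q : ℝ} (hq : 0 < q) (x : Fin M → Fin N → ℝ) :
    mixedNorm q x ≤ (M : ℝ) ^ (1 / q) * √N * ‖x‖ := by
  have h1 : ∀ i, rowNorm x i ≤ √N * ‖x‖ := by
    intro i
    rw [rowNorm, Real.sqrt_le_left (by positivity), mul_pow, Real.sq_sqrt (by positivity)]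
    calc ∑ j, x i j ^ 2 ≤ ∑ _j : Fin N, ‖x‖ ^ 2 := by
          refine Finset.sum_le_sum fun j _ => ?_
          rw [← sq_abs]
          gcongr
          exact (norm_le_pi_norm (x i) j).trans (norm_le_pi_norm x i)
      _ = _ := by simp
  calc mixedNorm q x ≤ (∑ _i : Fin M, (√N * ‖x‖) ^ q) ^ (1 / q) := by
        refine Real.rpow_le_rpow (Finset.sum_nonneg fun i _ =>
          Real.rpow_nonneg (rowNorm_nonneg x i) _) ?_ (by positivity)
        exact Finset.sum_le_sum fun i _ => Real.rpow_le_rpow (rowNorm_nonneg x i) (h1 i) hq.le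
    _ = _ := by
        rw [Finset.sum_const, Finset.card_univ, Fintype.card_fin, nsmul_eq_mul,
          Real.mul_rpow (by positivity) (by positivity), ← Real.rpow_mul (by positivity),
          mul_one_div_cancel hq.ne', Real.rpow_one, mul_assoc]

/-- Functions of a matrix that are `1`-Lipschitz for the `ℓ^q(ℓ²)` norm. -/
def MixedLipschitz (q : ℝ) (f : (Fin M → Fin N → ℝ) → ℝ) : Prop :=
  ∀ x y, |f x - f y| ≤ mixedNorm q (x - y)

/-- Functions of a matrix that are invariant under permutations of the rows. -/
def RowSymmetric (f : (Fin M → Fin N → ℝ) → ℝ) : Prop :=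
  ∀ (π : Equiv.Perm (Fin M)) (x : Fin M → Fin N → ℝ), f (fun i => x (π i)) = f x

lemma MixedLipschitz.lipschitzWith {q : ℝ} (hq : 0 < q) {f : (Fin M → Fin N → ℝ) → ℝ}
    (hf : MixedLipschitz q f) :
    LipschitzWith ⟨(M : ℝ) ^ (1 / q) * √N, by positivity⟩ f :=
  LipschitzWith.of_dist_le_mul fun x y => by
    rw [Real.dist_eq, dist_eq_norm]
    exact (hf x y).trans (mixedNorm_le hq _)

/-- Difference quotients obey the bound; at points of non-differentiability `fderiv` is `0` by
convention. -/
lemma MixedLipschitz.abs_fderiv_le {q : ℝ} (hq : 0 < q) {f : (Fin M → Fin N → ℝ) → ℝ}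
    (hf : MixedLipschitz q f) (x v : Fin M → Fin N → ℝ) :
    |fderiv ℝ f x v| ≤ mixedNorm q v := by
  by_cases hd : DifferentiableAt ℝ f x
  · have h := ((hd.hasFDerivAt.hasLineDerivAt v).tendsto_slope_zero).abs
    refine le_of_tendsto h ?_
    filter_upwards [self_mem_nhdsWithin] with t ht
    have ht : t ≠ 0 := ht
    rw [smul_eq_mul, abs_mul, abs_inv, inv_mul_le_iff₀ (abs_pos.2 ht), ← mixedNorm_smul hq]
    simpa using hf (x + t • v) x
  · rw [fderiv_zero_of_not_differentiableAt hd]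
    simpa using mixedNorm_nonneg q v

/-- The matrix unit `e i j`. -/
def matUnit (i : Fin M) (j : Fin N) : Fin M → Fin N → ℝ := Pi.single i (Pi.single j 1)

lemma map_eq_sum_matUnit (L : (Fin M → Fin N → ℝ) →L[ℝ] ℝ) (v : Fin M → Fin N → ℝ) :
    L v = ∑ i, ∑ j, v i j * L (matUnit i j) := by
  have h : v = ∑ i, ∑ j, v i j • matUnit i j := by
    ext k l
    simp only [Finset.sum_apply, Pi.smul_apply, smul_eq_mul, matUnit]
    rw [Finset.sum_eq_single k, Finset.sum_eq_single l]
    · simp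
    · intro j _ hj
      simp [hj.symm]
    · simp
    · intro i _ hi
      refine Finset.sum_eq_zero fun j _ => ?_
      simp [hi.symm]
    · simp
  conv_lhs => rw [h]
  simp

/-- The gradient of `f`, as a matrix. -/
def grad (f : (Fin M → Fin N → ℝ) → ℝ) (x : Fin M → Fin N → ℝ) : Fin M → Fin N → ℝ :=
  fun i j => fderiv ℝ f x (matUnit i j)

lemma fderiv_eq_sum_grad (f : (Fin M → Fin N → ℝ) → ℝ) (x v : Fin M → Fin N → ℝ) :
    fderiv ℝ f x v = ∑ i, ∑ j, v i j * grad f x i j := map_eq_sum_matUnit _ _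

lemma measurable_rowNorm_grad (f : (Fin M → Fin N → ℝ) → ℝ) (i : Fin M) :
    Measurable fun x => rowNorm (grad f x) i := by
  unfold rowNorm grad
  refine Measurable.sqrt (Finset.measurable_sum _ fun j _ => ?_)
  exact (measurable_fderiv_apply_const ℝ f _).pow_const 2

/-- The dual of `ℓ^q(ℓ²)` is `ℓ^p(ℓ²)`. Testing the derivative on the Hölder extremiser, row `i`
being `|∇_i f|^(p-2) ∇_i f`, gives `S ≤ S^(1/q)` for the sum `S`, which forces `S ≤ 1`. -/
lemma MixedLipschitz.sum_rowNorm_grad_le {p q : ℝ} (hpq : p.HolderConjugate q)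
    {f : (Fin M → Fin N → ℝ) → ℝ} (hf : MixedLipschitz q f) (x : Fin M → Fin N → ℝ) :
    ∑ i, rowNorm (grad f x) i ^ p ≤ 1 := by
  set r : Fin M → ℝ := fun i => rowNorm (grad f x) i with hr
  have hr0 : ∀ i, 0 ≤ r i := fun i => rowNorm_nonneg _ _
  have hp1 : 1 < p := hpq.lt
  have hp0 : 0 < p := hpq.pos
  have hq0 : 0 < q := hpq.symm.pos
  set S := ∑ i, r i ^ p with hS
  have hS0 : 0 ≤ S := Finset.sum_nonneg fun i _ => Real.rpow_nonneg (hr0 i) _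
  have h1 : fderiv ℝ f x (fun i j => r i ^ (p - 2) * grad f x i j) = S := by
    rw [fderiv_eq_sum_grad]
    refine Finset.sum_congr rfl fun i _ => ?_
    have e : ∀ j, r i ^ (p - 2) * grad f x i j * grad f x i j =
      r i ^ (p - 2) * grad f x i j ^ 2 := fun j => by ring
    simp_rw [e]
    rw [← Finset.mul_sum, ← rowNorm_sq]
    change r i ^ (p - 2) * r i ^ 2 = r i ^ p
    rcases (hr0 i).eq_or_lt with h0 | h0
    · rw [← h0, Real.zero_rpow hp0.ne']
      simp
    · rw [← Real.rpow_natCast, ← Real.rpow_add h0]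
      norm_num
  have h2 : mixedNorm q (fun i j => r i ^ (p - 2) * grad f x i j) = S ^ (1 / q) := by
    rw [mixedNorm, hS]
    congr 1
    refine Finset.sum_congr rfl fun i _ => ?_
    have e : rowNorm (fun i j => r i ^ (p - 2) * grad f x i j) i = r i ^ (p - 2) * r i := by
      simp only [rowNorm, hr, mul_pow]
      rw [← Finset.mul_sum, Real.sqrt_mul (sq_nonneg _), Real.sqrt_sq]
      exact Real.rpow_nonneg (Real.sqrt_nonneg _) _
    rw [e]
    rcases (hr0 i).eq_or_lt with h0 | h0
    · rw [← h0, Real.zero_rpow hp0.ne', mul_zero, Real.zero_rpow hq0.ne']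
    · rw [← Real.rpow_add_one h0.ne', ← Real.rpow_mul (hr0 i)]
      congr 1
      have := hpq.sub_one_mul_conj
      linear_combination this
  have h3 := hf.abs_fderiv_le hq0 x (fun i j => r i ^ (p - 2) * grad f x i j)
  rw [h1, h2, abs_of_nonneg hS0] at h3
  by_contra hcon
  push Not at hcon
  have h4 : S ^ (1 / q) < S ^ (1 : ℝ) := by
    refine Real.rpow_lt_rpow_of_exponent_lt hcon ?_
    rw [div_lt_one hq0]
    exact hpq.symm.lt
  rw [Real.rpow_one] at h4
  linarith

lemma MixedLipschitz.sum_rowNorm_grad_le_of_le {p q r : ℝ} (hpq : p.HolderConjugate q)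
    (hr : p ≤ r) {f : (Fin M → Fin N → ℝ) → ℝ} (hf : MixedLipschitz q f)
    (x : Fin M → Fin N → ℝ) : ∑ i, rowNorm (grad f x) i ^ r ≤ 1 := by
  have h := hf.sum_rowNorm_grad_le hpq x
  refine le_trans (Finset.sum_le_sum fun i _ => ?_) h
  have h0 := rowNorm_nonneg (grad f x) i
  have h1 : rowNorm (grad f x) i ^ p ≤ 1 := le_trans
    (Finset.single_le_sum (f := fun i => rowNorm (grad f x) i ^ p)
      (fun i _ => Real.rpow_nonneg (rowNorm_nonneg _ i) _) (Finset.mem_univ i)) h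
  have h2 : rowNorm (grad f x) i ≤ 1 := by
    by_contra hcon
    push Not at hcon
    exact absurd h1 (not_le.2 (Real.one_lt_rpow hcon hpq.pos))
  rcases h0.eq_or_lt with h | h
  · rw [← h, Real.zero_rpow hpq.pos.ne', Real.zero_rpow (hpq.pos.trans_le hr).ne']
  · exact Real.rpow_le_rpow_of_exponent_ge h h2 hr

/-- Chain rule for the linear map permuting the rows, which permutes the matrix units. -/
lemma RowSymmetric.rowNorm_grad {f : (Fin M → Fin N → ℝ) → ℝ} (hf : RowSymmetric f)
    (π : Equiv.Perm (Fin M)) (x : Fin M → Fin N → ℝ) (i : Fin M) :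
    rowNorm (grad f (fun k => x (π k))) i = rowNorm (grad f x) (π i) := by
  let P : (Fin M → Fin N → ℝ) ≃L[ℝ] (Fin M → Fin N → ℝ) :=
    (LinearEquiv.funCongrLeft ℝ (Fin N → ℝ) π).toContinuousLinearEquiv
  have hP : ∀ y, P y = fun k => y (π k) := fun y => rfl
  have hfP : f ∘ P = f := by
    ext y
    exact hf π y
  have h := P.comp_right_fderiv (f := f) (x := x)
  rw [hfP] at h
  have hu : ∀ j, P (matUnit (π i) j) = matUnit i j := by
    intro j
    rw [hP]
    ext k l
    simp only [matUnit, Pi.single_apply, π.injective.eq_iff]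
  simp only [rowNorm, grad]
  congr 1
  refine Finset.sum_congr rfl fun j _ => ?_
  rw [h, ContinuousLinearMap.comp_apply]
  simp only [ContinuousLinearEquiv.coe_coe]
  rw [hu, hP]

/-- Row symmetry makes the `M` expectations equal, and their sum is at most `1`. This is where
permutation invariance produces the gain. -/
lemma lintegral_rowNorm_grad_le {p q r : ℝ} (hpq : p.HolderConjugate q) (hr : p ≤ r)
    {f : (Fin M → Fin N → ℝ) → ℝ} (hf : MixedLipschitz q f) (hs : RowSymmetric f) (i : Fin M) :
    ∫⁻ x, ENNReal.ofReal (rowNorm (grad f x) i ^ r) ∂gaussMat M N ≤ (M : ℝ≥0∞)⁻¹ := by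
  have hm : ∀ k, Measurable fun x : Fin M → Fin N → ℝ =>
      ENNReal.ofReal (rowNorm (grad f x) k ^ r) := fun k =>
    ((measurable_rowNorm_grad f k).pow_const r).ennreal_ofReal
  have hsym : ∀ k, ∫⁻ x, ENNReal.ofReal (rowNorm (grad f x) k ^ r) ∂gaussMat M N =
      ∫⁻ x, ENNReal.ofReal (rowNorm (grad f x) i ^ r) ∂gaussMat M N := by
    intro k
    have hmp : MeasurePreserving (fun (x : Fin M → Fin N → ℝ) l => x (Equiv.swap i k l))
        (gaussMat M N) (gaussMat M N) :=
      (measurePreserving_piCongrLeft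
        (fun _ : Fin M => Measure.pi fun _ : Fin N => stdNormal) (Equiv.swap i k)).symm
    rw [← hmp.lintegral_comp (hm i)]
    refine lintegral_congr fun x => ?_
    rw [hs.rowNorm_grad, Equiv.swap_apply_left]
  have hsum : ∑ k : Fin M, ∫⁻ x, ENNReal.ofReal (rowNorm (grad f x) k ^ r) ∂gaussMat M N ≤ 1 := by
    rw [← lintegral_finsetSum _ fun k _ => hm k]
    calc _ ≤ ∫⁻ _x : Fin M → Fin N → ℝ, 1 ∂gaussMat M N := by
          refine lintegral_mono fun x => ?_
          rw [← ENNReal.ofReal_sum_of_nonneg fun k _ => Real.rpow_nonneg (rowNorm_nonneg _ k) _,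
            ENNReal.ofReal_le_one]
          exact hf.sum_rowNorm_grad_le_of_le hpq hr x
      _ = 1 := by simp
  simp_rw [hsym] at hsum
  rw [Finset.sum_const, Finset.card_univ, Fintype.card_fin, nsmul_eq_mul, mul_comm] at hsum
  exact ENNReal.le_inv_iff_mul_le.2 hsum

lemma lintegral_sum_mul_sq (a : Fin M → Fin N → ℝ) :
    ∫⁻ z, ENNReal.ofReal ((∑ i, ∑ j, z i j * a i j) ^ 2) ∂gaussMat M N =
      ENNReal.ofReal (∑ i, ∑ j, a i j ^ 2) := by
  have hS2 : ∀ i, MemLp (fun r : Fin N → ℝ => ∑ j, r j * a i j) 2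
      (Measure.pi fun _ : Fin N => stdNormal) := fun i =>
    memLp_finsetSum _ fun j _ =>
      ((memLp_id_gaussianReal 2).comp_measurePreserving
        (measurePreserving_eval (fun _ : Fin N => stdNormal) j)).mul_const _
  have hT2 : MemLp (fun z : Fin M → Fin N → ℝ => ∑ i, ∑ j, z i j * a i j) 2 (gaussMat M N) :=
    memLp_finsetSum _ fun i _ => (hS2 i).comp_measurePreserving
        (measurePreserving_eval (fun _ : Fin M => Measure.pi fun _ : Fin N => stdNormal) i)
  have hv1 : ∀ i, Var[fun r : Fin N → ℝ => ∑ j, r j * a i j;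
      Measure.pi fun _ : Fin N => stdNormal] = ∑ j, a i j ^ 2 := by
    intro i
    have := variance_sum_pi (μ := fun _ : Fin N => stdNormal) (X := fun j x => x * a i j)
      (fun j => (memLp_id_gaussianReal 2).mul_const _)
    rw [show (fun r : Fin N → ℝ => ∑ j, r j * a i j) = ∑ j, fun r : Fin N → ℝ => r j * a i j by
      ext; simp, this]
    refine Finset.sum_congr rfl fun j _ => ?_
    rw [variance_mul_const, variance_fun_id_gaussianReal]
    simp
  have hv2 : Var[fun z : Fin M → Fin N → ℝ => ∑ i, ∑ j, z i j * a i j; gaussMat M N] =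
      ∑ i, ∑ j, a i j ^ 2 := by
    have := variance_sum_pi (μ := fun _ : Fin M => Measure.pi fun _ : Fin N => stdNormal)
      (X := fun i r => ∑ j, r j * a i j) hS2
    rw [show (fun z : Fin M → Fin N → ℝ => ∑ i, ∑ j, z i j * a i j) =
      ∑ i, fun z : Fin M → Fin N → ℝ => ∑ j, z i j * a i j by ext; simp, this]
    exact Finset.sum_congr rfl fun i _ => hv1 i
  have hS1 : ∀ i, ∫ r, ∑ j, r j * a i j ∂(Measure.pi fun _ : Fin N => stdNormal) = 0 := by
    intro i
    have hi : ∀ j, Integrable (fun r : Fin N → ℝ => r j * a i j)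
        (Measure.pi fun _ : Fin N => stdNormal) := fun j =>
      (((memLp_id_gaussianReal 2).comp_measurePreserving
        (measurePreserving_eval (fun _ : Fin N => stdNormal) j)).mul_const _).integrable
          (by norm_num)
    rw [integral_finsetSum _ fun j _ => hi j]
    refine Finset.sum_eq_zero fun j _ => ?_
    rw [integral_mul_const]
    have := integral_comp_eval (μ := fun _ : Fin N => stdNormal) (i := j) (f := fun x : ℝ => x)
      (by fun_prop)
    rw [this, integral_id_gaussianReal, zero_mul]
  have hT1 : ∫ z, ∑ i, ∑ j, z i j * a i j ∂gaussMat M N = 0 := by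
    have hi : ∀ i, Integrable (fun z : Fin M → Fin N → ℝ => ∑ j, z i j * a i j) (gaussMat M N) :=
      fun i => ((hS2 i).comp_measurePreserving (measurePreserving_eval
        (fun _ : Fin M => Measure.pi fun _ : Fin N => stdNormal) i)).integrable (by norm_num)
    rw [integral_finsetSum _ fun i _ => hi i]
    refine Finset.sum_eq_zero fun i _ => ?_
    have := integral_comp_eval (μ := fun _ : Fin M => Measure.pi fun _ : Fin N => stdNormal)
      (i := i) (f := fun r : Fin N → ℝ => ∑ j, r j * a i j) (hS2 i).aestronglyMeasurable
    rw [this, hS1]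
  rw [← hv2, variance_of_integral_eq_zero hT2.aestronglyMeasurable.aemeasurable hT1,
    ofReal_integral_eq_lintegral_ofReal hT2.integrable_sq (ae_of_all _ fun z => sq_nonneg _)]

/-! ### `L^r` bounds for rotating all rows or a single row -/

/-- An entrywise pair of matrices, as a pair of matrices. -/
def unzip {α β : Type*} (ω : Fin M → Fin N → α × β) : (Fin M → Fin N → α) × (Fin M → Fin N → β) :=
  (fun i j => (ω i j).1, fun i j => (ω i j).2)

lemma measurePreserving_unzip {α β : Type*} [MeasurableSpace α] [MeasurableSpace β]
    (m : Measure α) (m' : Measure β) [IsProbabilityMeasure m] [IsProbabilityMeasure m'] :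
    MeasurePreserving (unzip (M := M) (N := N)) (Measure.pi fun _ => Measure.pi fun _ => m.prod m')
      ((Measure.pi fun _ => Measure.pi fun _ => m).prod
        (Measure.pi fun _ => Measure.pi fun _ => m')) := by
  have h1 := measurePreserving_arrowProdEquivProdArrow α β (Fin N) (fun _ => m) (fun _ => m')
  have h2 := measurePreserving_arrowProdEquivProdArrow (Fin N → α) (Fin N → β) (Fin M)
    (fun _ => Measure.pi fun _ => m) (fun _ => Measure.pi fun _ => m')
  exact h2.comp (measurePreserving_pi (ι := Fin M) _ _ fun _ => h1)

/-- The direction is built from the second matrix, independent of the point of differentiation.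
Given that point, the derivative is a centred Gaussian linear form with second moment `∑ m_i² |∇_i
f|²`; Jensen lowers the exponent from `2` to `r`. -/
lemma lintegral_fderiv_rpow_le (f : (Fin M → Fin N → ℝ) → ℝ) (m : Fin M → ℝ) {r : ℝ} (hr0 : 0 < r)
    (hr2 : r ≤ 2) :
    ∫⁻ ω, ‖fderiv ℝ f (mix 0 ω) (fun i j => m i * (ω i j).2)‖ₑ ^ r ∂gaussPair M N ≤
      ∫⁻ x, ENNReal.ofReal (∑ i, m i ^ 2 * rowNorm (grad f x) i ^ 2) ^ (r / 2) ∂gaussMat M N := by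
  have hgm : ∀ i j, Measurable fun x => grad f x i j := fun i j =>
    measurable_fderiv_apply_const ℝ f _
  set Φ : (Fin M → Fin N → ℝ) × (Fin M → Fin N → ℝ) → ℝ≥0∞ := fun w =>
    ‖∑ i, ∑ j, w.2 i j * (m i * grad f w.1 i j)‖ₑ with hΦ
  have hΦm : Measurable Φ := by
    refine Measurable.enorm (Finset.measurable_sum _ fun i _ => Finset.measurable_sum _ fun j _ => ?_)
    refine Measurable.mul (by fun_prop) (Measurable.const_mul ?_ _)
    exact (hgm i j).comp measurable_fst
  calc ∫⁻ ω, ‖fderiv ℝ f (mix 0 ω) (fun i j => m i * (ω i j).2)‖ₑ ^ r ∂gaussPair M N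
      = ∫⁻ ω, Φ (unzip ω) ^ r ∂gaussPair M N := by
        refine lintegral_congr fun ω => ?_
        rw [fderiv_eq_sum_grad, hΦ, mix_zero]
        congr 2
        refine Finset.sum_congr rfl fun i _ => Finset.sum_congr rfl fun j _ => ?_
        simp only [unzip]
        ring
    _ = ∫⁻ x, ∫⁻ z, Φ (x, z) ^ r ∂gaussMat M N ∂gaussMat M N := by
        rw [(measurePreserving_unzip stdNormal stdNormal).lintegral_comp (f := fun w => Φ w ^ r) (hΦm.pow_const r),
          lintegral_prod _ (hΦm.pow_const r).aemeasurable]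
    _ ≤ _ := by
        refine lintegral_mono fun x => ?_
        have h1 := lintegral_le_rpow (gaussMat M N) (f := fun z => Φ (x, z) ^ r) (p := 2 / r)
          ((hΦm.comp measurable_prodMk_left).pow_const r) (by rw [le_div_iff₀ hr0]; linarith)
        refine h1.trans (le_of_eq ?_)
        rw [one_div_div]
        congr 1
        calc ∫⁻ z, (Φ (x, z) ^ r) ^ (2 / r) ∂gaussMat M N
            = ∫⁻ z, ENNReal.ofReal ((∑ i, ∑ j, z i j * (m i * grad f x i j)) ^ 2)
                ∂gaussMat M N := by
              refine lintegral_congr fun z => ?_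
              rw [← ENNReal.rpow_mul, mul_div_cancel₀ _ hr0.ne']
              simp only [hΦ]
              rw [Real.enorm_eq_ofReal_abs, ENNReal.ofReal_rpow_of_nonneg (abs_nonneg _) (by norm_num)]
              congr 1
              rw [← sq_abs]
              norm_cast
          _ = _ := by
              rw [lintegral_sum_mul_sq]
              congr 1
              refine Finset.sum_congr rfl fun i _ => ?_
              rw [rowNorm_sq, Finset.mul_sum]
              exact Finset.sum_congr rfl fun j _ => mul_pow _ _ _

/-- Since `p ≤ 2`, the squared row norms of the gradient also sum to at most `1`, so the bound is
dimension-free. -/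
lemma eLpNorm_rotate_all_le {p q : ℝ} (hpq : p.HolderConjugate q) (hp2 : p ≤ 2)
    {f : (Fin M → Fin N → ℝ) → ℝ} (hf : MixedLipschitz q f) (θ : ℝ) :
    eLpNorm (fun ω => f (mix 0 ω) - f (mix (fun _ => θ) ω)) 2 (gaussPair M N) ≤
      ENNReal.ofReal |θ| := by
  have h := eLpNorm_mix_sub_le (hf.lipschitzWith hpq.symm.pos) (fun _ => 1) θ (p := 2)
    (by norm_num) (by norm_num)
  rw [show (θ • fun _ : Fin M => (1 : ℝ)) = fun _ => θ by ext; simp] at h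
  refine h.trans (mul_le_of_le_one_right' ?_)
  rw [eLpNorm_eq_lintegral_rpow_enorm_toReal (by norm_num) (by norm_num)]
  refine ENNReal.rpow_le_one ?_ (by positivity)
  rw [ENNReal.toReal_ofNat]
  refine (lintegral_fderiv_rpow_le f (fun _ => 1) two_pos le_rfl).trans ?_
  calc _ ≤ ∫⁻ _x : Fin M → Fin N → ℝ, 1 ∂gaussMat M N := by
        refine lintegral_mono fun x => ENNReal.rpow_le_one ?_ (by norm_num)
        rw [ENNReal.ofReal_le_one]
        have := hf.sum_rowNorm_grad_le_of_le hpq hp2 x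
        simpa using this
    _ = 1 := by simp

lemma eLpNorm_rotate_row_le {p q r : ℝ} (hpq : p.HolderConjugate q) (hpr : p ≤ r) (hr2 : r ≤ 2)
    {f : (Fin M → Fin N → ℝ) → ℝ} (hf : MixedLipschitz q f) (hs : RowSymmetric f) (i : Fin M)
    (θ : ℝ) :
    eLpNorm (fun ω => f (mix 0 ω) - f (mix (Pi.single i θ) ω)) (ENNReal.ofReal r)
        (gaussPair M N) ≤ ENNReal.ofReal |θ| * (M : ℝ≥0∞)⁻¹ ^ (1 / r) := by
  have hr1 : 1 ≤ r := hpq.lt.le.trans hpr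
  have hr0 : 0 < r := by linarith
  have h := eLpNorm_mix_sub_le (hf.lipschitzWith hpq.symm.pos) (Pi.single i 1) θ
    (p := ENNReal.ofReal r) (by simpa using hr1) ENNReal.ofReal_ne_top
  rw [show (θ • Pi.single i (1 : ℝ) : Fin M → ℝ) = Pi.single i θ by
    rw [← Pi.single_smul, smul_eq_mul, mul_one]] at h
  refine h.trans (mul_le_mul_right ?_ _)
  rw [eLpNorm_eq_lintegral_rpow_enorm_toReal (by simpa using hr0) ENNReal.ofReal_ne_top,
    ENNReal.toReal_ofReal hr0.le]
  refine ENNReal.rpow_le_rpow ?_ (by positivity)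
  refine (lintegral_fderiv_rpow_le f _ hr0 hr2).trans ?_
  refine le_trans (le_of_eq ?_) (lintegral_rowNorm_grad_le hpq hpr hf hs i)
  refine lintegral_congr fun x => ?_
  rw [Finset.sum_eq_single i]
  · rw [Pi.single_eq_same, one_pow, one_mul, ENNReal.ofReal_rpow_of_nonneg (sq_nonneg _)
      (by positivity), ← Real.rpow_natCast, ← Real.rpow_mul (rowNorm_nonneg _ _)]
    congr 2
    push_cast
    ring
  · intro k _ hk
    simp [Pi.single_eq_of_ne hk]
  · simp

end RandomFeasibility

/-! ### Correlations under row-by-row decorrelation -/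

namespace RandomFeasibility

variable {M N : ℕ}

/-- The correlation of `f` at a Gaussian matrix and at its rotation by the angle `t i` in row `i`. -/
def corr (f : (Fin M → Fin N → ℝ) → ℝ) (t : Fin M → ℝ) : ℝ :=
  ∫ ω, f (mix 0 ω) * f (mix t ω) ∂gaussPair M N

section Quad

/-- The law of an entrywise quadruple of independent standard Gaussian matrices. -/
abbrev gaussQuad (M N : ℕ) : Measure (Fin M → Fin N → (ℝ × ℝ) × (ℝ × ℝ)) :=
  Measure.pi fun _ => Measure.pi fun _ => (stdNormal.prod stdNormal).prod (stdNormal.prod stdNormal)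

/-- Apply `φ` to the entries of row `i`, and the first projection to the other entries. -/
def rowMap (i : Fin M) (φ : (ℝ × ℝ) × (ℝ × ℝ) → ℝ × ℝ) (ω : Fin M → Fin N → (ℝ × ℝ) × (ℝ × ℝ)) :
    Fin M → Fin N → ℝ × ℝ := fun k l => if k = i then φ (ω k l) else (ω k l).1

lemma measurePreserving_rowMap (i : Fin M) {φ : (ℝ × ℝ) × (ℝ × ℝ) → ℝ × ℝ}
    (hφ : MeasurePreserving φ ((stdNormal.prod stdNormal).prod (stdNormal.prod stdNormal))
      (stdNormal.prod stdNormal)) :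
    MeasurePreserving (rowMap (N := N) i φ) (gaussQuad M N) (gaussPair M N) := by
  refine measurePreserving_pi _ _ (f := fun k (r : Fin N → (ℝ × ℝ) × (ℝ × ℝ)) l =>
    if k = i then φ (r l) else (r l).1) fun k => measurePreserving_pi _ _
      (f := fun _ w => if k = i then φ w else w.1) fun l => ?_
  by_cases hk : k = i
  · simpa [hk] using hφ
  · simpa [hk] using measurePreserving_fst

/-- Independent copies of the two matrices of an entrywise pair rotated by the angles `t`. -/
def rotQuad (t : Fin M → ℝ) (ω : Fin M → Fin N → (ℝ × ℝ) × (ℝ × ℝ)) : Fin M → Fin N → ℝ × ℝ :=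
  fun k l => Prod.map (fun z : ℝ × ℝ => Real.cos (t k) * z.1 + Real.sin (t k) * z.2)
    (Prod.snd : ℝ × ℝ → ℝ) (ω k l)

/-- The first entries of the two pairs of an entrywise quadruple. -/
def fstQuad (ω : Fin M → Fin N → (ℝ × ℝ) × (ℝ × ℝ)) : Fin M → Fin N → ℝ × ℝ :=
  fun k l => Prod.map (Prod.fst : ℝ × ℝ → ℝ) (Prod.fst : ℝ × ℝ → ℝ) (ω k l)

lemma measurePreserving_rotQuad (t : Fin M → ℝ) :
    MeasurePreserving (rotQuad (N := N) t) (gaussQuad M N) (gaussPair M N) :=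
  measurePreserving_pi _ _ (f := fun k (r : Fin N → (ℝ × ℝ) × (ℝ × ℝ)) l =>
    Prod.map (fun z : ℝ × ℝ => Real.cos (t k) * z.1 + Real.sin (t k) * z.2)
      (Prod.snd : ℝ × ℝ → ℝ) (r l)) fun _ => measurePreserving_pi _ _ fun _ =>
    (measurePreserving_rotate_fst (Real.cos_sq_add_sin_sq _)).prod measurePreserving_snd

lemma measurePreserving_fstQuad :
    MeasurePreserving (fstQuad (M := M) (N := N)) (gaussQuad M N) (gaussPair M N) :=
  measurePreserving_pi _ _ (f := fun _ (r : Fin N → (ℝ × ℝ) × (ℝ × ℝ)) l =>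
    Prod.map (Prod.fst : ℝ × ℝ → ℝ) (Prod.fst : ℝ × ℝ → ℝ) (r l))
    fun _ => measurePreserving_pi _ _ fun _ =>
      measurePreserving_fst.prod measurePreserving_fst

/-- In each entry the first coordinates have correlation `cos (t k)` and the resampled ones are
independent; `rotate` and `of_indep` are tensorised over both coordinates and all entries. -/
lemma hypercontractive_quad {t : Fin M → ℝ} (ht : ∀ k, |Real.cos (t k)| ≤ 1 / 8) :
    Hypercontractive (gaussQuad M N) fstQuad (rotQuad t) := by
  refine Hypercontractive.pi (X := fun _ (r : Fin N → (ℝ × ℝ) × (ℝ × ℝ)) l =>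
    Prod.map (Prod.fst : ℝ × ℝ → ℝ) (Prod.fst : ℝ × ℝ → ℝ) (r l))
    (Y := fun k (r : Fin N → (ℝ × ℝ) × (ℝ × ℝ)) l =>
      Prod.map (fun z : ℝ × ℝ => Real.cos (t k) * z.1 + Real.sin (t k) * z.2)
      (Prod.snd : ℝ × ℝ → ℝ) (r l)) (fun k => ?_) (fun k => by fun_prop) (fun k => by fun_prop)
  refine Hypercontractive.pi (X := fun _ => Prod.map (Prod.fst : ℝ × ℝ → ℝ) (Prod.fst : ℝ × ℝ → ℝ))
    (Y := fun _ => Prod.map (fun z : ℝ × ℝ => Real.cos (t k) * z.1 + Real.sin (t k) * z.2)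
      (Prod.snd : ℝ × ℝ → ℝ)) (fun l => ?_) (fun k => by fun_prop) (fun k => by fun_prop)
  exact (Hypercontractive.rotate (ht k) (Real.cos_sq_add_sin_sq _)).prod
    (Hypercontractive.of_indep (X := fun x : ℝ => x) (Y := fun x : ℝ => x) (by fun_prop)
      (by fun_prop)) (by fun_prop) (by fun_prop) (by fun_prop) (by fun_prop)

variable {f : (Fin M → Fin N → ℝ) → ℝ}

lemma memLp_comp_mix {K : NNReal} (hf : LipschitzWith K f) (t : Fin M → ℝ) :
    MemLp (fun ω => f (mix t ω)) 2 (gaussPair M N) :=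
  (memLp_lipschitz hf (by norm_num)).comp_measurePreserving (measurePreserving_mix t)

/-- The difference of `f` at a matrix and at the matrix with an independently resampled row. -/
def rowDiff (f : (Fin M → Fin N → ℝ) → ℝ) (i : Fin M) (ω : Fin M → Fin N → ℝ × ℝ) : ℝ :=
  f (mix 0 ω) - f (mix (Pi.single i (Real.pi / 2)) ω)

/-- Expand the product into four correlations. As soon as row `i` is resampled in one or both
arguments, the two copies of that row are independent, which is the angle `π/2`. These three terms
have signs `-`, `-`, `+` and leave a single `-`. -/
lemma integral_rowDiff_mul_rowDiff {K : NNReal} (hf : LipschitzWith K f) (t : Fin M → ℝ)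
    (i : Fin M) :
    ∫ ω, rowDiff f i (fstQuad ω) * rowDiff f i (rotQuad t ω) ∂gaussQuad M N =
      corr f t - corr f (Function.update t i (Real.pi / 2)) := by
  set t' := Function.update t i (Real.pi / 2) with ht'
  have hti : t' i = Real.pi / 2 := Function.update_self ..
  have htk : ∀ k, k ≠ i → t' k = t k := fun k hk => Function.update_of_ne hk ..
  set S : (s : Fin M → ℝ) → (Fin M → Fin N → ℝ × ℝ) → ℝ := fun s ω =>
    f (mix 0 ω) * f (mix s ω) with hS
  have hSi : ∀ s, Integrable (S s) (gaussPair M N) := fun s =>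
    (memLp_comp_mix hf 0).integrable_mul (memLp_comp_mix hf s)
  have hrot : MeasurePreserving (fun z : ℝ × ℝ => Real.cos (t i) * z.1 + Real.sin (t i) * z.2)
      (stdNormal.prod stdNormal) stdNormal :=
    measurePreserving_rotate_fst (Real.cos_sq_add_sin_sq _)
  have h0 := measurePreserving_rowMap (N := N) i (φ := Prod.fst) measurePreserving_fst
  have h1 := measurePreserving_rowMap (N := N) i
    ((measurePreserving_fst (μ := stdNormal) (ν := stdNormal)).prod
      (measurePreserving_snd (μ := stdNormal) (ν := stdNormal)))
  have h2 := measurePreserving_rowMap (N := N) i (Measure.measurePreserving_swap.comp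
    (hrot.prod (measurePreserving_fst (μ := stdNormal) (ν := stdNormal))))
  have h3 := measurePreserving_rowMap (N := N) i (φ := Prod.snd) measurePreserving_snd
  have hint : ∀ {T : (Fin M → Fin N → (ℝ × ℝ) × (ℝ × ℝ)) → Fin M → Fin N → ℝ × ℝ}
      (_ : MeasurePreserving T (gaussQuad M N) (gaussPair M N)) (s : Fin M → ℝ),
      ∫ ω, S s (T ω) ∂gaussQuad M N = corr f s := by
    intro T hT s
    have := integral_map (μ := gaussQuad M N) hT.aemeasurable (f := S s)
      (by rw [hT.map_eq]; exact (hSi s).aestronglyMeasurable)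
    rw [← this, hT.map_eq, corr]
  have i0 := h0.integrable_comp_of_integrable (hSi t)
  have i1 := h1.integrable_comp_of_integrable (hSi t')
  have i2 := h2.integrable_comp_of_integrable (hSi t')
  have i3 := h3.integrable_comp_of_integrable (hSi t')
  -- Each of the four terms is `f (mix 0 ·) * f (mix s ·)` at a pair whose row `i` is chosen from
  -- the quadruple: the original pair, only the second argument resampled, only the first, or both.
  have key : ∀ ω : Fin M → Fin N → (ℝ × ℝ) × (ℝ × ℝ),
      rowDiff f i (fstQuad ω) * rowDiff f i (rotQuad t ω) =
      (S t (rowMap i Prod.fst ω) - S t' (rowMap i (Prod.map Prod.fst Prod.snd) ω)) -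
      (S t' (rowMap i (Prod.swap ∘ Prod.map
        (fun z : ℝ × ℝ => Real.cos (t i) * z.1 + Real.sin (t i) * z.2) Prod.fst) ω) -
        S t' (rowMap i Prod.snd ω)) := by
    intro ω
    have a1 : mix 0 (rowMap i Prod.fst ω) = mix 0 (fstQuad ω) := by
      ext k l
      simp [mix_zero, rowMap, fstQuad]
    have a2 : mix t (rowMap i Prod.fst ω) = mix 0 (rotQuad t ω) := by
      ext k l
      simp [mix, rowMap, rotQuad]
    have b1 : mix 0 (rowMap i (Prod.map Prod.fst Prod.snd) ω) = mix 0 (fstQuad ω) := by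
      ext k l
      by_cases hk : k = i <;> simp [mix_zero, rowMap, fstQuad, hk]
    have b2 : mix t' (rowMap i (Prod.map Prod.fst Prod.snd) ω) =
        mix (Pi.single i (Real.pi / 2)) (rotQuad t ω) := by
      ext k l
      by_cases hk : k = i
      · subst hk
        simp [mix, rowMap, rotQuad, hti]
      · simp [mix, rowMap, rotQuad, hk, htk]
    have c1 : mix 0 (rowMap i (Prod.swap ∘ Prod.map
        (fun z : ℝ × ℝ => Real.cos (t i) * z.1 + Real.sin (t i) * z.2) Prod.fst) ω) =
        mix (Pi.single i (Real.pi / 2)) (fstQuad ω) := by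
      ext k l
      by_cases hk : k = i
      · subst hk
        simp [mix, rowMap, fstQuad]
      · simp [mix, rowMap, fstQuad, hk]
    have c2 : mix t' (rowMap i (Prod.swap ∘ Prod.map
        (fun z : ℝ × ℝ => Real.cos (t i) * z.1 + Real.sin (t i) * z.2) Prod.fst) ω) =
        mix 0 (rotQuad t ω) := by
      ext k l
      by_cases hk : k = i
      · subst hk
        simp [mix, rowMap, rotQuad, hti]
      · simp [mix, rowMap, rotQuad, hk, htk]
    have d1 : mix 0 (rowMap i Prod.snd ω) = mix (Pi.single i (Real.pi / 2)) (fstQuad ω) := by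
      ext k l
      by_cases hk : k = i
      · subst hk
        simp [mix, rowMap, fstQuad]
      · simp [mix, rowMap, fstQuad, hk]
    have d2 : mix t' (rowMap i Prod.snd ω) = mix (Pi.single i (Real.pi / 2)) (rotQuad t ω) := by
      ext k l
      by_cases hk : k = i
      · subst hk
        simp [mix, rowMap, rotQuad, hti]
      · simp [mix, rowMap, rotQuad, hk, htk]
    simp only [hS, rowDiff, a1, a2, b1, b2, c1, c2, d1, d2]
    ring
  simp_rw [key]
  have j01 : ∫ ω, (S t (rowMap i Prod.fst ω) - S t' (rowMap i (Prod.map Prod.fst Prod.snd) ω))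
      ∂gaussQuad M N = corr f t - corr f t' := by
    rw [← hint h0 t, ← hint h1 t']
    exact integral_sub i0 i1
  have j23 : ∫ ω, (S t' (rowMap i (Prod.swap ∘ Prod.map
        (fun z : ℝ × ℝ => Real.cos (t i) * z.1 + Real.sin (t i) * z.2) Prod.fst) ω) -
        S t' (rowMap i Prod.snd ω)) ∂gaussQuad M N = corr f t' - corr f t' := by
    nth_rewrite 1 [← hint h2 t']
    rw [← hint h3 t']
    exact integral_sub i2 i3
  rw [integral_sub ?_ ?_, j01, j23, sub_self, sub_zero]
  · exact i0.sub i1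
  · exact i2.sub i3

/-- Hypercontractivity bounds the product of row increments by an `L^(4/3)` norm times an `L²` norm.
As `4/3 ≤ p`, the first is at most the `L^p` norm, of order `M^(-1/p)`; the second is of order
`M^(-1/2)`. -/
lemma corr_sub_update_le {p q : ℝ} (hpq : p.HolderConjugate q) (hp : 4 / 3 ≤ p) (hp2 : p ≤ 2)
    (hf : MixedLipschitz q f) (hs : RowSymmetric f) {t : Fin M → ℝ}
    (ht : ∀ k, |Real.cos (t k)| ≤ 1 / 8) (i : Fin M) :
    corr f t - corr f (Function.update t i (Real.pi / 2)) ≤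
      (Real.pi / 2) ^ 2 * (M : ℝ) ^ (-(1 / p + 1 / 2)) := by
  have hM : (0 : ℝ) < M := Nat.cast_pos.2 (Nat.pos_of_ne_zero fun h => by subst h; exact i.elim0)
  have hL := hf.lipschitzWith hpq.symm.pos
  have hDc : Continuous fun x : Fin M → Fin N → ℝ => f x := hL.continuous
  have hDm : Measurable (rowDiff f i) :=
    (hDc.measurable.comp (measurePreserving_mix _).measurable).sub
      (hDc.measurable.comp (measurePreserving_mix _).measurable)
  have hH := hypercontractive_quad (N := N) ht (fun ω => ‖rowDiff f i ω‖ₑ)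
    (fun ω => ‖rowDiff f i ω‖ₑ) hDm.enorm hDm.enorm
  have e1 : ∫⁻ ω, ‖rowDiff f i (fstQuad ω)‖ₑ ^ (4 / 3 : ℝ) ∂gaussQuad M N =
      ∫⁻ ω, ‖rowDiff f i ω‖ₑ ^ (4 / 3 : ℝ) ∂gaussPair M N :=
    measurePreserving_fstQuad.lintegral_comp (hDm.enorm.pow_const _)
  have e2 : ∫⁻ ω, ‖rowDiff f i (rotQuad t ω)‖ₑ ^ (2 : ℝ) ∂gaussQuad M N =
      ∫⁻ ω, ‖rowDiff f i ω‖ₑ ^ (2 : ℝ) ∂gaussPair M N :=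
    (measurePreserving_rotQuad t).lintegral_comp (hDm.enorm.pow_const _)
  have n1 : (∫⁻ ω, ‖rowDiff f i ω‖ₑ ^ (4 / 3 : ℝ) ∂gaussPair M N) ^ (3 / 4 : ℝ) ≤
      ENNReal.ofReal (Real.pi / 2) * (M : ℝ≥0∞)⁻¹ ^ (1 / p) := by
    have a := eLpNorm_rotate_row_le hpq le_rfl hp2 hf hs i (Real.pi / 2)
    rw [abs_of_pos (by positivity)] at a
    refine le_trans ?_ a
    have b := eLpNorm_le_eLpNorm_of_exponent_le (μ := gaussPair M N)
      (ENNReal.ofReal_le_ofReal hp) hDm.aestronglyMeasurable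
    refine le_trans (le_of_eq ?_) b
    rw [eLpNorm_eq_lintegral_rpow_enorm_toReal (by norm_num) ENNReal.ofReal_ne_top,
      ENNReal.toReal_ofReal (by norm_num)]
    norm_num
  have n2 : (∫⁻ ω, ‖rowDiff f i ω‖ₑ ^ (2 : ℝ) ∂gaussPair M N) ^ (1 / 2 : ℝ) ≤
      ENNReal.ofReal (Real.pi / 2) * (M : ℝ≥0∞)⁻¹ ^ (1 / 2 : ℝ) := by
    have a := eLpNorm_rotate_row_le hpq hp2 le_rfl hf hs i (Real.pi / 2)
    rw [abs_of_pos (by positivity)] at a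
    refine le_trans (le_of_eq ?_) a
    rw [eLpNorm_eq_lintegral_rpow_enorm_toReal (by norm_num) ENNReal.ofReal_ne_top,
      ENNReal.toReal_ofReal (by norm_num)]
    rfl
  rw [e1, e2] at hH
  have hfin := hH.trans (mul_le_mul' n1 n2)
  rw [← integral_rowDiff_mul_rowDiff hL t i]
  have hM' : (M : ℝ≥0∞)⁻¹ = ENNReal.ofReal (M : ℝ)⁻¹ := by
    rw [ENNReal.ofReal_inv_of_pos hM, ENNReal.ofReal_natCast]
  rw [hM', ENNReal.ofReal_rpow_of_pos (by positivity), ENNReal.ofReal_rpow_of_pos (by positivity),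
    ← ENNReal.ofReal_mul (by positivity), ← ENNReal.ofReal_mul (by positivity),
    ← ENNReal.ofReal_mul (by positivity)] at hfin
  have e3 : Real.pi / 2 * (M : ℝ)⁻¹ ^ (1 / p) * (Real.pi / 2 * (M : ℝ)⁻¹ ^ (1 / 2 : ℝ)) =
      (Real.pi / 2) ^ 2 * (M : ℝ) ^ (-(1 / p + 1 / 2)) := by
    rw [Real.rpow_neg hM.le, Real.rpow_add hM, Real.inv_rpow hM.le, Real.inv_rpow hM.le, mul_inv]
    ring
  rw [e3] at hfin
  have h5 : ENNReal.ofReal (∫ ω, rowDiff f i (fstQuad ω) * rowDiff f i (rotQuad t ω)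
      ∂gaussQuad M N) ≤ ENNReal.ofReal ((Real.pi / 2) ^ 2 * (M : ℝ) ^ (-(1 / p + 1 / 2))) := by
    refine (Real.ofReal_le_enorm _).trans ((enorm_integral_le_lintegral_enorm _).trans ?_)
    simp_rw [enorm_mul]
    exact hfin
  exact (ENNReal.ofReal_le_ofReal_iff (by positivity)).1 h5

lemma corr_pi_div_two {K : NNReal} (hf : LipschitzWith K f) :
    corr f (fun _ => Real.pi / 2) = (∫ x, f x ∂gaussMat M N) ^ 2 := by
  have hmp := measurePreserving_unzip (M := M) (N := N) stdNormal stdNormal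
  have h1 := integral_map (μ := gaussPair M N) hmp.aemeasurable
    (f := fun w : (Fin M → Fin N → ℝ) × (Fin M → Fin N → ℝ) => f w.1 * f w.2)
    (by
      have := hf.continuous
      exact Continuous.aestronglyMeasurable (by fun_prop))
  rw [hmp.map_eq, integral_prod_mul] at h1
  rw [sq, h1, corr]
  congr 1
  ext ω
  rw [mix_zero]
  simp only [unzip]
  congr 2
  ext i j
  simp [mix]

/-- Start from angle `π/2` in every row, where the correlation is the squared mean, here `0`, and
switch rows to angle `a` one by one. The `M` costs add up to order `M · M^(-(1/p + 1/2))`. -/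
lemma corr_const_le {p q : ℝ} (hpq : p.HolderConjugate q) (hp : 4 / 3 ≤ p) (hp2 : p ≤ 2)
    (hf : MixedLipschitz q f) (hs : RowSymmetric f) (h0 : ∫ x, f x ∂gaussMat M N = 0) {a : ℝ}
    (ha : |Real.cos a| ≤ 1 / 8) :
    corr f (fun _ => a) ≤ (Real.pi / 2) ^ 2 * (M : ℝ) ^ (1 / 2 - 1 / p) := by
  classical
  have hL := hf.lipschitzWith hpq.symm.pos
  set B := (Real.pi / 2) ^ 2 * (M : ℝ) ^ (-(1 / p + 1 / 2)) with hB
  have key : ∀ S : Finset (Fin M), corr f (fun k => if k ∈ S then a else Real.pi / 2) ≤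
      S.card * B := by
    intro S
    induction S using Finset.induction_on with
    | empty =>
      simp only [Finset.notMem_empty, if_false, Finset.card_empty, Nat.cast_zero, zero_mul]
      rw [corr_pi_div_two hL, h0]
      simp
    | insert i S hi ih =>
      have h := corr_sub_update_le hpq hp hp2 hf hs
        (t := fun k => if k ∈ insert i S then a else Real.pi / 2)
        (fun k => by
          by_cases hk : k ∈ insert i S
          · simpa only [hk, if_true] using ha
          · simp only [hk, if_false, Real.cos_pi_div_two]
            norm_num) i
      have e : Function.update (fun k => if k ∈ insert i S then a else Real.pi / 2) i
          (Real.pi / 2) = fun k => if k ∈ S then a else Real.pi / 2 := by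
        ext k
        by_cases hk : k = i
        · subst hk
          simp [hi]
        · simp [hk]
      rw [e] at h
      rw [Finset.card_insert_of_notMem hi]
      push_cast
      linarith
  have h := key Finset.univ
  simp only [Finset.mem_univ, if_true, Finset.card_univ, Fintype.card_fin] at h
  rcases Nat.eq_zero_or_pos M with hM | hM
  · subst hM
    refine h.trans ?_
    rw [Nat.cast_zero, zero_mul]
    exact mul_nonneg (by positivity) (Real.rpow_nonneg le_rfl _)
  · refine h.trans (le_of_eq ?_)
    have hM' : (0 : ℝ) < M := Nat.cast_pos.2 hM
    rw [hB, show (1 / 2 - 1 / p : ℝ) = 1 + -(1 / p + 1 / 2) by ring, Real.rpow_add hM',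
      Real.rpow_one]
    ring

end Quad

end RandomFeasibility

/-! ### From one fixed angle to the variance -/

namespace RandomFeasibility

variable {M N : ℕ} {f : (Fin M → Fin N → ℝ) → ℝ}

/-- For independent `x, z, z'`, the rotations of `x` towards `z` and towards `z'` have correlation
`cos² a`. The second output is chosen so that rotating the pair by `b` turns `cos a x + sin a z`
into `cos a x + sin a z'`. -/
lemma measurePreserving_doubling {a b : ℝ} (hb : Real.cos b = Real.cos a ^ 2)
    (hb0 : Real.sin b ≠ 0) :
    MeasurePreserving (fun w : ℝ × (ℝ × ℝ) => (Real.cos a * w.1 + Real.sin a * w.2.1,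
      Real.cos a * Real.sin a / Real.sin b * (Real.sin a * w.1 + -Real.cos a * w.2.1) +
        Real.sin a / Real.sin b * w.2.2))
      (stdNormal.prod (stdNormal.prod stdNormal)) (stdNormal.prod stdNormal) := by
  have hs : Real.sin b ^ 2 = Real.sin a ^ 2 * (1 + Real.cos a ^ 2) := by
    have h1 := Real.sin_sq_add_cos_sq b
    have h2 := Real.sin_sq_add_cos_sq a
    rw [hb] at h1
    have h3 : Real.sin a ^ 2 = 1 - Real.cos a ^ 2 := by linarith
    rw [h3]
    linear_combination h1
  have h1 : MeasurePreserving (fun z : ℝ × ℝ => (Real.cos a * z.1 + Real.sin a * z.2,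
      Real.sin a * z.1 + -Real.cos a * z.2)) (stdNormal.prod stdNormal)
      (stdNormal.prod stdNormal) :=
    measurePreserving_orthogonal (Real.cos_sq_add_sin_sq a)
      (by rw [neg_sq]; exact Real.sin_sq_add_cos_sq a) (by ring)
  have h2 : MeasurePreserving (fun z : ℝ × ℝ =>
      Real.cos a * Real.sin a / Real.sin b * z.1 + Real.sin a / Real.sin b * z.2)
      (stdNormal.prod stdNormal) stdNormal := by
    refine measurePreserving_rotate_fst ?_
    field_simp
    rw [hs]
    ring
  have h3 := (measurePreserving_prodAssoc stdNormal stdNormal stdNormal).symm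
  have h4 := measurePreserving_prodAssoc stdNormal stdNormal stdNormal
  exact ((MeasurePreserving.id stdNormal).prod h2).comp (h4.comp
    ((h1.prod (MeasurePreserving.id stdNormal)).comp h3))

/-- Let `P f` average `f` over the second matrix. Then `corr f a = ⟨f, P f⟩`, while `‖P f‖² = corr f
b` because its two factors use independent noises. The claim is Cauchy–Schwarz. -/
lemma corr_sq_le {K : NNReal} (hf : LipschitzWith K f) {a b : ℝ}
    (hb : Real.cos b = Real.cos a ^ 2) (hb0 : Real.sin b ≠ 0) :
    corr f (fun _ => a) ^ 2 ≤ (∫ x, f x ^ 2 ∂gaussMat M N) * corr f (fun _ => b) := by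
  have hc := hf.continuous
  set rot : (Fin M → Fin N → ℝ) → (Fin M → Fin N → ℝ) → Fin M → Fin N → ℝ := fun x z i j =>
    Real.cos a * x i j + Real.sin a * z i j with hrot
  have hrotc : Continuous fun w : (Fin M → Fin N → ℝ) × (Fin M → Fin N → ℝ) => rot w.1 w.2 := by
    fun_prop
  set P : (Fin M → Fin N → ℝ) → ℝ := fun x => ∫ z, f (rot x z) ∂gaussMat M N with hP
  have hmp := measurePreserving_unzip (M := M) (N := N) stdNormal stdNormal
  have hmixP : ∀ ω : Fin M → Fin N → ℝ × ℝ, mix (fun _ => a) ω = rot (unzip ω).1 (unzip ω).2 :=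
    fun ω => rfl
  have hfst : ∀ ω : Fin M → Fin N → ℝ × ℝ, mix 0 ω = (unzip ω).1 := fun ω => mix_zero ω
  have hrotx : ∀ x, LipschitzWith K fun z => f (rot x z) := by
    intro x
    have : LipschitzWith 1 (rot x) := LipschitzWith.of_dist_le_mul fun z z' => by
      rw [NNReal.coe_one, one_mul, dist_pi_le_iff dist_nonneg]
      intro i
      rw [dist_pi_le_iff dist_nonneg]
      intro j
      have h1 : dist (z i j) (z' i j) ≤ dist z z' :=
        (dist_le_pi_dist (z i) (z' i) j).trans (dist_le_pi_dist z z' i)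
      simp only [hrot, Real.dist_eq] at h1 ⊢
      rw [show Real.cos a * x i j + Real.sin a * z i j - (Real.cos a * x i j + Real.sin a * z' i j)
        = Real.sin a * (z i j - z' i j) by ring, abs_mul]
      exact (mul_le_of_le_one_left (abs_nonneg _) (Real.abs_sin_le_one a)).trans h1
    have h := hf.comp this
    rwa [mul_one] at h
  have hrotz : ∀ z x x', dist (f (rot x z)) (f (rot x' z)) ≤ K * dist x x' := by
    intro z x x'
    refine (hf.dist_le_mul _ _).trans ?_
    gcongr
    rw [dist_pi_le_iff dist_nonneg]
    intro i
    rw [dist_pi_le_iff dist_nonneg]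
    intro j
    have h1 : dist (x i j) (x' i j) ≤ dist x x' :=
      (dist_le_pi_dist (x i) (x' i) j).trans (dist_le_pi_dist x x' i)
    simp only [hrot, Real.dist_eq] at h1 ⊢
    rw [show Real.cos a * x i j + Real.sin a * z i j - (Real.cos a * x' i j + Real.sin a * z i j)
      = Real.cos a * (x i j - x' i j) by ring, abs_mul]
    exact (mul_le_of_le_one_left (abs_nonneg _) (Real.abs_cos_le_one a)).trans h1
  have hzi : ∀ x, Integrable (fun z => f (rot x z)) (gaussMat M N) := fun x =>
    (memLp_lipschitz (hrotx x) (p := 1) (by norm_num)).integrable le_rfl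
  -- The Lipschitz bound for `P` is what supplies its square integrability.
  have hPL : LipschitzWith K P := LipschitzWith.of_dist_le_mul fun x x' => by
    rw [Real.dist_eq, hP, ← integral_sub (hzi x) (hzi x')]
    calc |∫ z, f (rot x z) - f (rot x' z) ∂gaussMat M N|
        ≤ ∫ z, |f (rot x z) - f (rot x' z)| ∂gaussMat M N := abs_integral_le_integral_abs
      _ ≤ ∫ _z : Fin M → Fin N → ℝ, K * dist x x' ∂gaussMat M N :=
          integral_mono ((hzi x).sub (hzi x')).abs (integrable_const _) fun z => hrotz z x x'
      _ = _ := by simp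
  have hcorr : corr f (fun _ => a) = ∫ x, f x * P x ∂gaussMat M N := by
    have hi : Integrable (fun ω : Fin M → Fin N → ℝ × ℝ => f (mix 0 ω) * f (mix (fun _ => a) ω))
        (gaussPair M N) := (memLp_comp_mix hf 0).integrable_mul (memLp_comp_mix hf _)
    have hm : AEStronglyMeasurable (fun w : (Fin M → Fin N → ℝ) × (Fin M → Fin N → ℝ) =>
        f w.1 * f (rot w.1 w.2)) ((gaussMat M N).prod (gaussMat M N)) :=
      Continuous.aestronglyMeasurable (by fun_prop)
    have hi2 : Integrable (fun w : (Fin M → Fin N → ℝ) × (Fin M → Fin N → ℝ) =>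
        f w.1 * f (rot w.1 w.2)) ((gaussMat M N).prod (gaussMat M N)) := by
      rw [← hmp.integrable_comp hm]
      refine hi.congr (ae_of_all _ fun ω => ?_)
      simp only [Function.comp_apply, hmixP, hfst]
    have h1 := integral_map (μ := gaussPair M N) hmp.aemeasurable
      (f := fun w : (Fin M → Fin N → ℝ) × (Fin M → Fin N → ℝ) => f w.1 * f (rot w.1 w.2))
      (by rw [hmp.map_eq]; exact hm)
    rw [hmp.map_eq, integral_prod _ hi2] at h1
    rw [corr]
    simp_rw [hmixP, hfst]
    rw [← h1]
    refine integral_congr_ae (ae_of_all _ fun x => ?_)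
    simp only [hP]
    rw [integral_const_mul]
  have hPP : ∫ x, P x ^ 2 ∂gaussMat M N = corr f (fun _ => b) := by
    have hD := measurePreserving_doubling hb hb0
    have hΨ := measurePreserving_pi (ι := Fin M) _ _ fun _ =>
      measurePreserving_pi (ι := Fin N) _ _ fun _ => hD
    set Ψ := fun (ω : Fin M → Fin N → ℝ × (ℝ × ℝ)) i j =>
      ((fun w : ℝ × (ℝ × ℝ) => (Real.cos a * w.1 + Real.sin a * w.2.1,
      Real.cos a * Real.sin a / Real.sin b * (Real.sin a * w.1 + -Real.cos a * w.2.1) +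
        Real.sin a / Real.sin b * w.2.2)) (ω i j)) with hΨdef
    have hU := ((MeasurePreserving.id (gaussMat M N)).prod hmp).comp
      (measurePreserving_unzip (M := M) (N := N) stdNormal (stdNormal.prod stdNormal))
    have hm : AEStronglyMeasurable (fun w : (Fin M → Fin N → ℝ) ×
        ((Fin M → Fin N → ℝ) × (Fin M → Fin N → ℝ)) => f (rot w.1 w.2.1) * f (rot w.1 w.2.2))
        ((gaussMat M N).prod ((gaussMat M N).prod (gaussMat M N))) :=
      Continuous.aestronglyMeasurable (by fun_prop)
    have hm2 : AEStronglyMeasurable (fun ω : Fin M → Fin N → ℝ × ℝ =>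
        f (mix 0 ω) * f (mix (fun _ => b) ω)) (gaussPair M N) :=
      ((memLp_comp_mix hf 0).integrable_mul (memLp_comp_mix hf _)).aestronglyMeasurable
    have hid : ∀ ω : Fin M → Fin N → ℝ × (ℝ × ℝ),
        (fun w : (Fin M → Fin N → ℝ) × ((Fin M → Fin N → ℝ) × (Fin M → Fin N → ℝ)) =>
          f (rot w.1 w.2.1) * f (rot w.1 w.2.2)) ((Prod.map id unzip ∘ unzip) ω) =
        f (mix 0 (Ψ ω)) * f (mix (fun _ => b) (Ψ ω)) := by
      intro ω
      have e1 : mix 0 (Ψ ω) = rot (unzip ω).1 (unzip (unzip ω).2).1 := by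
        ext i j
        simp [mix_zero, hΨdef, hrot, unzip]
      have e2 : mix (fun _ => b) (Ψ ω) = rot (unzip ω).1 (unzip (unzip ω).2).2 := by
        ext i j
        simp only [mix, hΨdef, hrot, unzip, hb]
        field_simp
        have h2 := Real.sin_sq_add_cos_sq a
        linear_combination (Real.cos a * (ω i j).1) * h2
      rw [e1, e2]
      rfl
    have h1 := integral_map hU.aemeasurable (f := fun w : (Fin M → Fin N → ℝ) ×
        ((Fin M → Fin N → ℝ) × (Fin M → Fin N → ℝ)) => f (rot w.1 w.2.1) * f (rot w.1 w.2.2))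
      (by rw [hU.map_eq]; exact hm)
    have h2 := integral_map hΨ.aemeasurable (f := fun ω : Fin M → Fin N → ℝ × ℝ =>
        f (mix 0 ω) * f (mix (fun _ => b) ω)) (by rw [hΨ.map_eq]; exact hm2)
    simp_rw [hid] at h1
    rw [hΨ.map_eq] at h2
    have hi2 : Integrable (fun ω : Fin M → Fin N → ℝ × (ℝ × ℝ) =>
        f (mix 0 (Ψ ω)) * f (mix (fun _ => b) (Ψ ω)))
        (Measure.pi fun _ => Measure.pi fun _ => stdNormal.prod (stdNormal.prod stdNormal)) :=
      hΨ.integrable_comp_of_integrable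
        ((memLp_comp_mix hf 0).integrable_mul (memLp_comp_mix hf fun _ => b))
    have hi : Integrable (fun w : (Fin M → Fin N → ℝ) ×
        ((Fin M → Fin N → ℝ) × (Fin M → Fin N → ℝ)) => f (rot w.1 w.2.1) * f (rot w.1 w.2.2))
        ((gaussMat M N).prod ((gaussMat M N).prod (gaussMat M N))) := by
      rw [← hU.integrable_comp hm]
      exact hi2.congr (ae_of_all _ fun ω => (hid ω).symm)
    rw [hU.map_eq, integral_prod _ hi] at h1
    rw [corr, h2, ← h1]
    refine integral_congr_ae (ae_of_all _ fun x => ?_)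
    simp only
    rw [integral_prod_mul (fun z => f (rot x z)) (fun z => f (rot x z)), ← sq]
  rw [hcorr, ← hPP]
  exact sq_integral_mul_le (memLp_lipschitz hf (by norm_num)) (memLp_lipschitz hPL (by norm_num))

/-- Expanding, `‖f(X) - f(X_θ)‖² = 2 E f² - 2 corr(θ)`, and rotating all rows bounds the left side
by `θ²`. -/
lemma integral_sq_le_corr_add {p q : ℝ} (hpq : p.HolderConjugate q) (hp2 : p ≤ 2)
    (hf : MixedLipschitz q f) (θ : ℝ) :
    ∫ x, f x ^ 2 ∂gaussMat M N ≤ corr f (fun _ => θ) + θ ^ 2 / 2 := by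
  have hL := hf.lipschitzWith hpq.symm.pos
  have h := eLpNorm_rotate_all_le hpq hp2 hf θ
  have m0 := memLp_comp_mix hL 0
  have m1 := memLp_comp_mix hL fun _ => θ
  have hsq : ∀ t : Fin M → ℝ, ∫ ω, f (mix t ω) ^ 2 ∂gaussPair M N =
      ∫ x, f x ^ 2 ∂gaussMat M N := by
    intro t
    have hmp := measurePreserving_mix (N := N) t
    have := integral_map (μ := gaussPair M N) hmp.aemeasurable (f := fun x => f x ^ 2)
      (by have := hL.continuous; exact Continuous.aestronglyMeasurable (by fun_prop))
    rw [hmp.map_eq] at this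
    exact this.symm
  have h1 : ∫ ω, (f (mix 0 ω) - f (mix (fun _ => θ) ω)) ^ 2 ∂gaussPair M N =
      2 * (∫ x, f x ^ 2 ∂gaussMat M N) - 2 * corr f (fun _ => θ) := by
    have e : ∀ ω : Fin M → Fin N → ℝ × ℝ, (f (mix 0 ω) - f (mix (fun _ => θ) ω)) ^ 2 =
        (f (mix 0 ω) ^ 2 + f (mix (fun _ => θ) ω) ^ 2) -
          2 * (f (mix 0 ω) * f (mix (fun _ => θ) ω)) := by
      intro ω; ring
    have hm : Integrable (fun ω : Fin M → Fin N → ℝ × ℝ => f (mix 0 ω) * f (mix (fun _ => θ) ω))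
        (gaussPair M N) := m0.integrable_mul m1
    simp_rw [e]
    rw [integral_sub ?_ (hm.const_mul 2), integral_add m0.integrable_sq m1.integrable_sq, hsq, hsq,
      integral_const_mul, corr]
    · ring
    · exact m0.integrable_sq.add m1.integrable_sq
  have h2 : ENNReal.ofReal (∫ ω, (f (mix 0 ω) - f (mix (fun _ => θ) ω)) ^ 2 ∂gaussPair M N) ≤
      ENNReal.ofReal (θ ^ 2) := by
    have hi : Integrable (fun ω : Fin M → Fin N → ℝ × ℝ =>
        (f (mix 0 ω) - f (mix (fun _ => θ) ω)) ^ 2) (gaussPair M N) := (m0.sub m1).integrable_sq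
    rw [ofReal_integral_eq_lintegral_ofReal hi (ae_of_all _ fun ω => sq_nonneg _)]
    have h3 := pow_le_pow_left₀ zero_le h 2
    rw [eLpNorm_eq_lintegral_rpow_enorm_toReal (by norm_num) (by norm_num), ENNReal.toReal_ofNat,
      ← ENNReal.rpow_natCast, ← ENNReal.rpow_mul] at h3
    norm_num at h3
    rw [← ENNReal.ofReal_pow (abs_nonneg _), sq_abs] at h3
    refine le_trans (le_of_eq ?_) h3
    refine lintegral_congr fun ω => ?_
    rw [Real.enorm_eq_ofReal_abs, ← ENNReal.ofReal_pow (abs_nonneg _), sq_abs]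
  rw [ENNReal.ofReal_le_ofReal_iff (sq_nonneg _), h1] at h2
  linarith

/-- Angles whose cosines are the successive square roots of `1 / 8`. -/
def halfAngle (k : ℕ) : ℝ := Real.arccos ((1 / 8 : ℝ) ^ ((1 / 2 : ℝ) ^ k))

lemma cos_halfAngle (k : ℕ) : Real.cos (halfAngle k) = (1 / 8 : ℝ) ^ ((1 / 2 : ℝ) ^ k) := by
  refine Real.cos_arccos ?_ ?_
  · linarith [Real.rpow_nonneg (by norm_num : (0 : ℝ) ≤ 1 / 8) ((1 / 2 : ℝ) ^ k)]
  · exact Real.rpow_le_one (by norm_num) (by norm_num) (by positivity)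

lemma cos_halfAngle_succ (k : ℕ) :
    Real.cos (halfAngle k) = Real.cos (halfAngle (k + 1)) ^ 2 := by
  rw [cos_halfAngle, cos_halfAngle, ← Real.rpow_natCast (_ ^ _) 2,
    ← Real.rpow_mul (by norm_num)]
  congr 1
  push_cast
  ring

lemma sin_halfAngle_ne_zero (k : ℕ) : Real.sin (halfAngle k) ≠ 0 := by
  intro h
  have h1 := Real.sin_sq_add_cos_sq (halfAngle k)
  have h2 : Real.cos (halfAngle k) < 1 := by
    rw [cos_halfAngle]
    exact Real.rpow_lt_one (by norm_num) (by norm_num) (by positivity)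
  have h3 : 0 ≤ Real.cos (halfAngle k) := by
    rw [cos_halfAngle]
    positivity
  rw [h] at h1
  nlinarith

lemma tendsto_halfAngle : Tendsto halfAngle atTop (𝓝 0) := by
  have h1 : Tendsto (fun k : ℕ => (1 / 8 : ℝ) ^ ((1 / 2 : ℝ) ^ k)) atTop (𝓝 1) := by
    have h2 : Tendsto (fun k : ℕ => (1 / 2 : ℝ) ^ k) atTop (𝓝 0) :=
      tendsto_pow_atTop_nhds_zero_of_lt_one (by norm_num) (by norm_num)
    have h3 := (Real.continuous_const_rpow (by norm_num : (1 / 8 : ℝ) ≠ 0)).tendsto 0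
    rw [Real.rpow_zero] at h3
    exact h3.comp h2
  have h4 := (Real.continuous_arccos.tendsto 1).comp h1
  rwa [Real.arccos_one] at h4

/-- The bound on correlations at `halfAngle k` obtained from a bound at `halfAngle 0`. -/
def corrBound (η : ℝ) : ℕ → ℝ
  | 0 => η
  | k + 1 => √(2 * corrBound η k)

lemma corrBound_nonneg {η : ℝ} (hη : 0 ≤ η) (k : ℕ) : 0 ≤ corrBound η k := by
  cases k with
  | zero => exact hη
  | succ k => exact Real.sqrt_nonneg _

lemma tendsto_corrBound (k : ℕ) : Tendsto (fun η => corrBound η k) (𝓝 0) (𝓝 0) := by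
  induction k with
  | zero => exact tendsto_id
  | succ k ih =>
    have := (Real.continuous_sqrt.tendsto _).comp (ih.const_mul 2)
    rwa [mul_zero, Real.sqrt_zero] at this

lemma integral_sq_le_corrBound {p q : ℝ} (hpq : p.HolderConjugate q) (hp : 4 / 3 ≤ p)
    (hp2 : p ≤ 2) (hf : MixedLipschitz q f) (hs : RowSymmetric f)
    (h0 : ∫ x, f x ∂gaussMat M N = 0) (k : ℕ) :
    ∫ x, f x ^ 2 ∂gaussMat M N ≤
      corrBound ((Real.pi / 2) ^ 2 * (M : ℝ) ^ (1 / 2 - 1 / p)) k + halfAngle k ^ 2 / 2 := by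
  have hL := hf.lipschitzWith hpq.symm.pos
  set η := (Real.pi / 2) ^ 2 * (M : ℝ) ^ (1 / 2 - 1 / p) with hη
  have hη0 : 0 ≤ η := by positivity
  -- At angle `π/2` the correlation of a centred `f` vanishes, leaving `π²/8 ≤ 2`. This `2` is the
  -- factor in `corrBound`.
  have hV : ∫ x, f x ^ 2 ∂gaussMat M N ≤ 2 := by
    have h1 := integral_sq_le_corr_add hpq hp2 hf (Real.pi / 2)
    rw [corr_pi_div_two hL, h0] at h1
    have h2 := Real.pi_lt_four
    have h3 := Real.pi_pos
    nlinarith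
  have hV0 : 0 ≤ ∫ x, f x ^ 2 ∂gaussMat M N := integral_nonneg fun x => sq_nonneg _
  have key : ∀ k, corr f (fun _ => halfAngle k) ≤ corrBound η k := by
    intro k
    induction k with
    | zero =>
      refine corr_const_le hpq hp hp2 hf hs h0 ?_
      rw [cos_halfAngle]
      norm_num
    | succ k ih =>
      have h1 := corr_sq_le hL (cos_halfAngle_succ k) (sin_halfAngle_ne_zero k)
      refine Real.le_sqrt_of_sq_le (h1.trans ?_)
      calc _ ≤ (∫ x, f x ^ 2 ∂gaussMat M N) * corrBound η k :=
            mul_le_mul_of_nonneg_left ih hV0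
        _ ≤ _ := mul_le_mul_of_nonneg_right hV (corrBound_nonneg hη0 k)
  have h1 := integral_sq_le_corr_add hpq hp2 hf (halfAngle k)
  linarith [key k]

/-- Superconcentration: the variance of a row-symmetric function of a Gaussian matrix that is
`1`-Lipschitz in the mixed `ℓ^q(ℓ²)` norm, `2 < q ≤ 4`, tends to `0` with the number of rows,
uniformly in the function and in the number of columns. -/
theorem exists_variance_le {q : ℝ} (hq : 2 < q) (hq4 : q ≤ 4) {ε : ℝ} (hε : 0 < ε) :
    ∃ M₀ : ℕ, ∀ (M : ℕ), M₀ ≤ M → ∀ (N : ℕ) (f : (Fin M → Fin N → ℝ) → ℝ), MixedLipschitz q f →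
      RowSymmetric f →
      ∫ x, (f x - ∫ y, f y ∂gaussMat M N) ^ 2 ∂gaussMat M N ≤ ε := by
  -- The condition `q ≤ 4` becomes `4/3 ≤ p`, as the `L^(4/3)` bound requires, and `q > 2` becomes
  -- `p < 2`, which makes the exponent `1/2 - 1/p` negative.
  set p := q / (q - 1) with hp
  have hpq : p.HolderConjugate q := (Real.HolderConjugate.conjExponent (by linarith)).symm
  have hq1 : 0 < q - 1 := by linarith
  have hp43 : 4 / 3 ≤ p := by
    rw [hp, le_div_iff₀ hq1]
    linarith
  have hp2 : p < 2 := by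
    rw [hp, div_lt_iff₀ hq1]
    linarith
  -- Order of limits: `k` is fixed by `ε` alone, so only a fixed number of square roots is applied
  -- to the bound that decays in `M`.
  obtain ⟨k, hk⟩ : ∃ k, halfAngle k ^ 2 / 2 < ε / 2 := by
    have h1 : Tendsto (fun k => halfAngle k ^ 2 / 2) atTop (𝓝 0) := by
      have := (tendsto_halfAngle.pow 2).div_const 2
      simpa using this
    exact (h1.eventually_lt_const (by positivity)).exists
  have hexp : 0 < 1 / p - 1 / 2 := by
    rw [sub_pos]
    exact one_div_lt_one_div_of_lt hpq.pos hp2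
  have hlim : Tendsto (fun M : ℕ => corrBound ((Real.pi / 2) ^ 2 * (M : ℝ) ^ (1 / 2 - 1 / p)) k)
      atTop (𝓝 0) := by
    refine (tendsto_corrBound k).comp ?_
    have h1 := (tendsto_rpow_neg_atTop hexp).comp (tendsto_natCast_atTop_atTop (R := ℝ))
    have h2 := h1.const_mul ((Real.pi / 2) ^ 2)
    rw [mul_zero] at h2
    refine h2.congr fun M => ?_
    simp
  obtain ⟨M₀, hM₀⟩ := eventually_atTop.1 (hlim.eventually_lt_const (half_pos hε))
  refine ⟨M₀, fun M hM N f hf hs => ?_⟩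
  have hi : Integrable f (gaussMat M N) :=
    (memLp_lipschitz (hf.lipschitzWith hpq.symm.pos) (p := 1) (by norm_num)).integrable le_rfl
  set c := ∫ y, f y ∂gaussMat M N with hc
  have h1 := integral_sq_le_corrBound (f := fun x => f x - c) hpq hp43 hp2.le
    (fun x y => by simpa using hf x y) (fun π x => by simp only [hs π x])
    (by
      rw [integral_sub hi (integrable_const c), ← hc]
      simp) k
  linarith [hM₀ M hM]

end RandomFeasibility

/-! ### The margin as a Lipschitz, row-symmetric function -/

namespace RandomFeasibility

variable {M N : ℕ}

lemma sum_rpow_le_rpow {r : Fin M → ℝ} (hr : ∀ i, 0 ≤ r i) {p q : ℝ} (hp : 0 < p) (hpq : p ≤ q) :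
    ∑ i, r i ^ q ≤ ((∑ i, r i ^ p) ^ (1 / p)) ^ q := by
  set S := (∑ i, r i ^ p) ^ (1 / p) with hS
  have h0 : 0 ≤ ∑ i, r i ^ p := Finset.sum_nonneg fun i _ => Real.rpow_nonneg (hr i) _
  have hS0 : 0 ≤ S := Real.rpow_nonneg h0 _
  have hSp : S ^ p = ∑ i, r i ^ p := by
    rw [hS, ← Real.rpow_mul h0, one_div_mul_cancel hp.ne', Real.rpow_one]
  have hle : ∀ i, r i ≤ S := by
    intro i
    rw [← Real.rpow_le_rpow_iff (hr i) hS0 hp, hSp]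
    exact Finset.single_le_sum (f := fun i => r i ^ p) (fun i _ => Real.rpow_nonneg (hr i) _)
      (Finset.mem_univ i)
  have e : ∀ {x : ℝ}, 0 ≤ x → x ^ q = x ^ p * x ^ (q - p) := by
    intro x hx
    rw [← Real.rpow_add_of_nonneg hx hp.le (sub_nonneg.2 hpq)]
    congr 1
    ring
  calc ∑ i, r i ^ q = ∑ i, r i ^ p * r i ^ (q - p) := Finset.sum_congr rfl fun i _ => e (hr i)
    _ ≤ ∑ i, r i ^ p * S ^ (q - p) := Finset.sum_le_sum fun i _ =>
        mul_le_mul_of_nonneg_left (Real.rpow_le_rpow (hr i) (hle i) (sub_nonneg.2 hpq))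
          (Real.rpow_nonneg (hr i) _)
    _ = S ^ q := by rw [← Finset.sum_mul, ← hSp, ← e hS0]

lemma le_sum_rpow {r : Fin M → ℝ} (hr : ∀ i, 0 ≤ r i) {p : ℝ} (hp : 0 < p) (i : Fin M) :
    r i ≤ (∑ i, r i ^ p) ^ (1 / p) := by
  have h0 : 0 ≤ ∑ i, r i ^ p := Finset.sum_nonneg fun i _ => Real.rpow_nonneg (hr i) _
  rw [← Real.rpow_le_rpow_iff (hr i) (Real.rpow_nonneg h0 _) hp, ← Real.rpow_mul h0,
    one_div_mul_cancel hp.ne', Real.rpow_one]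
  exact Finset.single_le_sum (f := fun i => r i ^ p) (fun i _ => Real.rpow_nonneg (hr i) _)
    (Finset.mem_univ i)

/-- Monotonicity of `ℓ^p` norms, including `q = ∞`; it allows a Lipschitz bound in a smaller finite
exponent `p`. -/
lemma edist_toLp_le {q : ℝ≥0∞} {p : ℝ} (hp : 0 < p) (hpq : ENNReal.ofReal p ≤ q)
    {x y r : Fin M → ℝ} (hr : ∀ i, |x i - y i| ≤ r i) :
    edist (WithLp.toLp q x) (WithLp.toLp q y) ≤ ENNReal.ofReal ((∑ i, r i ^ p) ^ (1 / p)) := by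
  have hr0 : ∀ i, 0 ≤ r i := fun i => (abs_nonneg _).trans (hr i)
  have hd : ∀ i, edist (x i) (y i) ≤ ENNReal.ofReal (r i) := by
    intro i
    rw [edist_dist, Real.dist_eq]
    exact ENNReal.ofReal_le_ofReal (hr i)
  by_cases hq : q = ∞
  · subst hq
    rw [PiLp.edist_eq_iSup]
    exact iSup_le fun i => (hd i).trans (ENNReal.ofReal_le_ofReal (le_sum_rpow hr0 hp i))
  · have hpq' : p ≤ q.toReal := by rwa [ENNReal.ofReal_le_iff_le_toReal hq] at hpq
    have hq0 : 0 < q.toReal := hp.trans_le hpq'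
    have hS0 : 0 ≤ (∑ i, r i ^ p) ^ (1 / p) :=
      Real.rpow_nonneg (Finset.sum_nonneg fun i _ => Real.rpow_nonneg (hr0 i) _) _
    rw [PiLp.edist_eq_sum hq0]
    calc (∑ i, edist (x i) (y i) ^ q.toReal) ^ (1 / q.toReal)
        ≤ (∑ i, ENNReal.ofReal (r i ^ q.toReal)) ^ (1 / q.toReal) := by
          refine ENNReal.rpow_le_rpow (Finset.sum_le_sum fun i _ => ?_) (by positivity)
          rw [← ENNReal.ofReal_rpow_of_nonneg (hr0 i) hq0.le]
          exact ENNReal.rpow_le_rpow (hd i) hq0.le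
      _ ≤ (ENNReal.ofReal (((∑ i, r i ^ p) ^ (1 / p)) ^ q.toReal)) ^ (1 / q.toReal) := by
          rw [← ENNReal.ofReal_sum_of_nonneg fun i _ => Real.rpow_nonneg (hr0 i) _]
          exact ENNReal.rpow_le_rpow (ENNReal.ofReal_le_ofReal (sum_rpow_le_rpow hr0 hp hpq'))
            (by positivity)
      _ = _ := by
          rw [← ENNReal.ofReal_rpow_of_nonneg hS0 hq0.le, ← ENNReal.rpow_mul,
            mul_one_div_cancel hq0.ne', ENNReal.rpow_one]

section Margin

variable {q : ℝ≥0∞} {Q : Set (EuclideanSpace ℝ (Fin N))} {E : Set (Fin M → ℝ)}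

lemma lqDist_le_add [Fact (1 ≤ q)] (x y : Fin M → ℝ) (E : Set (Fin M → ℝ)) :
    lqDist q x E ≤ edist (WithLp.toLp q x) (WithLp.toLp q y) + lqDist q y E := by
  rw [add_comm, ← tsub_le_iff_right]
  refine le_iInf₂ fun z hz => ?_
  rw [tsub_le_iff_right, add_comm]
  exact (iInf₂_le z hz).trans (edist_triangle _ _ _)

lemma abs_mulVec_le_rowNorm {σ : EuclideanSpace ℝ (Fin N)} (hσ : ‖σ‖ ≤ 1)
    (A : Fin M → Fin N → ℝ) (i : Fin M) : |(Matrix.of A *ᵥ σ.ofLp) i| ≤ rowNorm A i := by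
  rw [Matrix.mulVec, dotProduct]
  simp only [Matrix.of_apply]
  refine Real.abs_le_sqrt ?_
  refine (Finset.sum_mul_sq_le_sq_mul_sq _ _ _).trans ?_
  refine mul_le_of_le_one_right (Finset.sum_nonneg fun j _ => sq_nonneg _) ?_
  have h1 : ‖σ‖ ^ 2 = ∑ j, σ.ofLp j ^ 2 := by
    rw [EuclideanSpace.norm_sq_eq]
    simp
  rw [← h1]
  exact pow_le_one₀ (norm_nonneg _) hσ

/-- As `‖σ‖₂ ≤ 1`, Cauchy–Schwarz bounds each coordinate of `(A - B)σ` by the norm of the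
corresponding row, uniformly in `σ ∈ Q`. -/
lemma margin_le_add [Fact (1 ≤ q)] {p : ℝ} (hp : 0 < p) (hpq : ENNReal.ofReal p ≤ q)
    (hQ : Q ⊆ Metric.closedBall 0 1) (A B : Fin M → Fin N → ℝ) :
    margin q Q E (Matrix.of A) ≤
      margin q Q E (Matrix.of B) + ENNReal.ofReal (mixedNorm p (A - B)) := by
  rw [← tsub_le_iff_right]
  refine le_iInf₂ fun σ hσ => ?_
  rw [tsub_le_iff_right]
  have hσ1 : ‖σ‖ ≤ 1 := by simpa using hQ hσ
  have h1 : margin q Q E (Matrix.of A) ≤ lqDist q (Matrix.of A *ᵥ σ.ofLp) E := iInf₂_le σ hσ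
  have h2 := lqDist_le_add (q := q) (Matrix.of A *ᵥ σ.ofLp) (Matrix.of B *ᵥ σ.ofLp) E
  have h3 : edist (WithLp.toLp q (Matrix.of A *ᵥ σ.ofLp)) (WithLp.toLp q (Matrix.of B *ᵥ σ.ofLp)) ≤
      ENNReal.ofReal (mixedNorm p (A - B)) := by
    refine edist_toLp_le hp hpq fun i => ?_
    have := abs_mulVec_le_rowNorm hσ1 (A - B) i
    rwa [← Matrix.of_sub_of, Matrix.sub_mulVec] at this
  refine h1.trans (h2.trans ?_)
  rw [add_comm]
  exact add_le_add_right h3 _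

lemma margin_ne_top [Fact (1 ≤ q)] (hQ : Q.Nonempty) (hE : E.Nonempty)
    (A : Matrix (Fin M) (Fin N) ℝ) : margin q Q E A ≠ ∞ := by
  obtain ⟨σ, hσ⟩ := hQ
  obtain ⟨y, hy⟩ := hE
  have h : margin q Q E A ≤ edist (WithLp.toLp q (A *ᵥ σ.ofLp)) (WithLp.toLp q y) :=
    (iInf₂_le σ hσ).trans (iInf₂_le y hy)
  exact (h.trans_lt (edist_lt_top _ _)).ne

lemma mixedLipschitz_margin [Fact (1 ≤ q)] {p : ℝ} (hp : 0 < p) (hpq : ENNReal.ofReal p ≤ q)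
    (hQ : Q ⊆ Metric.closedBall 0 1) (hQne : Q.Nonempty) (hE : E.Nonempty) :
    MixedLipschitz p fun A : Fin M → Fin N → ℝ => (margin q Q E (Matrix.of A)).toReal := by
  have key : ∀ A B : Fin M → Fin N → ℝ, (margin q Q E (Matrix.of A)).toReal ≤
      (margin q Q E (Matrix.of B)).toReal + mixedNorm p (A - B) := by
    intro A B
    have h := ENNReal.toReal_mono (ENNReal.add_ne_top.2
      ⟨margin_ne_top hQne hE _, ENNReal.ofReal_ne_top⟩) (margin_le_add (E := E) hp hpq hQ A B)
    rwa [ENNReal.toReal_add (margin_ne_top hQne hE _) ENNReal.ofReal_ne_top,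
      ENNReal.toReal_ofReal (mixedNorm_nonneg _ _)] at h
  intro A B
  have hBA : mixedNorm p (B - A) = mixedNorm p (A - B) := by
    have := mixedNorm_smul hp (-1) (A - B)
    simpa using this
  rw [abs_sub_le_iff]
  constructor
  · linarith [key A B]
  · linarith [key B A]

lemma lqDist_comp_perm_le [Fact (1 ≤ q)] (hE : PermutationSymmetric E) (π : Equiv.Perm (Fin M))
    (x : Fin M → ℝ) : lqDist q (fun i => x (π i)) E ≤ lqDist q x E := by
  refine le_iInf₂ fun y hy => ?_
  refine (iInf₂_le (fun i => y (π i)) ((hE π y).1 hy)).trans (le_of_eq ?_)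
  have h := (LinearIsometryEquiv.piLpCongrLeft q ℝ ℝ π.symm).edist_map (WithLp.toLp q x)
    (WithLp.toLp q y)
  rw [← h]
  rfl

lemma lqDist_comp_perm [Fact (1 ≤ q)] (hE : PermutationSymmetric E) (π : Equiv.Perm (Fin M))
    (x : Fin M → ℝ) : lqDist q (fun i => x (π i)) E = lqDist q x E := by
  refine le_antisymm (lqDist_comp_perm_le hE π x) ?_
  have := lqDist_comp_perm_le (q := q) hE π⁻¹ fun i => x (π i)
  simpa using this

/-- Permuting the rows of `A` permutes the coordinates of `Aσ`, an `ℓ^q` isometry that preserves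
`E`. -/
lemma rowSymmetric_margin [Fact (1 ≤ q)] (hE : PermutationSymmetric E) :
    RowSymmetric fun A : Fin M → Fin N → ℝ => (margin q Q E (Matrix.of A)).toReal := by
  intro π A
  simp only [margin]
  congr 1
  refine iInf_congr fun σ => iInf_congr fun _ => ?_
  rw [← lqDist_comp_perm hE π (Matrix.of A *ᵥ σ.ofLp)]
  rfl

lemma lqDist_le_of_mem_expansion {K : ℝ} {x : Fin M → ℝ} (hx : x ∈ expansion q E K) :
    0 ≤ K ∧ lqDist q x E ≤ ENNReal.ofReal K := by
  have hx' : (lqDist q x E : EReal) ≤ (K : EReal) := hx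
  have hK : 0 ≤ K := by
    have : (0 : EReal) ≤ (K : EReal) := (EReal.coe_ennreal_nonneg _).trans hx'
    exact_mod_cast this
  refine ⟨hK, ?_⟩
  have : ((ENNReal.ofReal K : ℝ≥0∞) : EReal) = (K : EReal) := by
    rw [EReal.coe_ennreal_ofReal, max_eq_left hK]
  rw [← this] at hx'
  exact EReal.coe_ennreal_le_coe_ennreal_iff.1 hx'

lemma mem_expansion_of_lt {K : ℝ} {x : Fin M → ℝ} (hx : lqDist q x E < ENNReal.ofReal K) :
    x ∈ expansion q E K := by
  have hK : 0 < K := by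
    rw [← ENNReal.ofReal_pos]
    exact pos_of_gt hx
  have : ((ENNReal.ofReal K : ℝ≥0∞) : EReal) = (K : EReal) := by
    rw [EReal.coe_ennreal_ofReal, max_eq_left hK.le]
  change (lqDist q x E : EReal) ≤ (K : EReal)
  rw [← this]
  exact EReal.coe_ennreal_le_coe_ennreal_iff.2 hx.le

lemma lqDist_eq_zero_of_mem [Fact (1 ≤ q)] {x : Fin M → ℝ} (hx : x ∈ E) : lqDist q x E = 0 :=
  le_antisymm ((iInf₂_le x hx).trans (by simp)) zero_le

lemma margin_eq_zero_of_hasSolution [Fact (1 ≤ q)] {A : Matrix (Fin M) (Fin N) ℝ}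
    (h : HasSolution Q E A) : margin q Q E A = 0 := by
  obtain ⟨σ, hσ, hA⟩ := h
  exact le_antisymm ((iInf₂_le σ hσ).trans (lqDist_eq_zero_of_mem hA).le) zero_le

/-- For `K ≥ 0`, the triangle inequality makes the margin to the expansion at least the margin to
`E` minus `K`. For `K < 0` the expansion is empty and the margin is `∞`. -/
lemma unsatisfiable_of_lt_margin [Fact (1 ≤ q)] {A : Matrix (Fin M) (Fin N) ℝ} {K : ℝ}
    (h : K < (margin q Q E A).toReal) :
    margin q Q (expansion q E K) A ≠ 0 ∧ ¬ HasSolution Q (expansion q E K) A := by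
  have h1 : margin q Q (expansion q E K) A ≠ 0 := by
    by_cases hK : 0 ≤ K
    · have hlt : ENNReal.ofReal K < margin q Q E A :=
        (ENNReal.ofReal_lt_iff_lt_toReal hK fun htop => by
          rw [htop, ENNReal.toReal_top] at h
          exact absurd hK (not_le.2 h)).2 h
      refine ((tsub_pos_of_lt hlt).trans_le ?_).ne'
      refine le_iInf₂ fun σ hσ => le_iInf₂ fun y hy => ?_
      rw [tsub_le_iff_right]
      have a : margin q Q E A ≤ lqDist q (A *ᵥ σ.ofLp) E := iInf₂_le σ hσ
      exact a.trans ((lqDist_le_add _ y E).trans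
        (add_le_add_right (lqDist_le_of_mem_expansion hy).2 _))
    · have hemp : expansion q E K = ∅ := by
        ext x
        simp only [Set.mem_empty_iff_false, iff_false]
        exact fun hx => hK (lqDist_le_of_mem_expansion hx).1
      rw [hemp]
      simp [margin, lqDist]
  exact ⟨h1, fun hs => h1 (margin_eq_zero_of_hasSolution hs)⟩

/-- Strictness provides a `σ` with distance below `K` even when the infimum is not attained. -/
lemma satisfiable_of_margin_lt [Fact (1 ≤ q)] {A : Matrix (Fin M) (Fin N) ℝ} {K : ℝ}
    (htop : margin q Q E A ≠ ∞) (h : (margin q Q E A).toReal < K) :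
    margin q Q (expansion q E K) A = 0 ∧ HasSolution Q (expansion q E K) A := by
  have hlt : margin q Q E A < ENNReal.ofReal K := (ENNReal.lt_ofReal_iff_toReal_lt htop).2 h
  obtain ⟨σ, hσ⟩ := iInf_lt_iff.1 hlt
  obtain ⟨hσQ, hσ⟩ := iInf_lt_iff.1 hσ
  have hs : HasSolution Q (expansion q E K) A := ⟨σ, hσQ, mem_expansion_of_lt hσ⟩
  exact ⟨margin_eq_zero_of_hasSolution hs, hs⟩

end Margin

lemma HasIndepStdNormalEntries.map_eq {Ω : Type*} [MeasurableSpace Ω] {P : Measure Ω}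
    [IsProbabilityMeasure P] {A : Ω → Matrix (Fin M) (Fin N) ℝ}
    (hA : HasIndepStdNormalEntries A P) :
    AEMeasurable (fun ω i j => A ω i j) P ∧ P.map (fun ω i j => A ω i j) = gaussMat M N := by
  have hm : ∀ p : Fin M × Fin N, AEMeasurable (fun ω => A ω p.1 p.2) P := fun p =>
    (hA.1 p.1 p.2).aemeasurable
  have hae : AEMeasurable (fun ω i j => A ω i j) P :=
    aemeasurable_pi_lambda _ fun i => aemeasurable_pi_lambda _ fun j => hm (i, j)
  refine ⟨hae, ?_⟩
  have h1 := (iIndepFun_iff_map_fun_eq_pi_map hm).1 hA.2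
  simp_rw [(hA.1 _ _).map_eq] at h1
  have h2 := Measure.infinitePi_map_curry fun (_ : Fin M) (_ : Fin N) => stdNormal
  simp_rw [Measure.infinitePi_eq_pi] at h2
  have h3 := AEMeasurable.map_map_of_aemeasurable
    (MeasurableEquiv.curry (Fin M) (Fin N) ℝ).measurable.aemeasurable
    (aemeasurable_pi_lambda _ hm)
  rw [h1] at h3
  exact h3.symm.trans h2

/-- Chebyshev's inequality. `S` need not be measurable: it lies in the preimage of a measurable
deviation set. -/
lemma HasIndepStdNormalEntries.measure_le {Ω : Type*} [MeasurableSpace Ω] {P : Measure Ω}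
    [IsProbabilityMeasure P] {A : Ω → Matrix (Fin M) (Fin N) ℝ}
    (hA : HasIndepStdNormalEntries A P) {f : (Fin M → Fin N → ℝ) → ℝ} {K : NNReal}
    (hf : LipschitzWith K f) {δ : ℝ} (hδ : 0 < δ) {S : Set Ω}
    (hS : ∀ ω ∈ S, δ ≤ |f (fun i j => A ω i j) - ∫ x, f x ∂gaussMat M N|) :
    P S ≤ ENNReal.ofReal
      ((∫ x, (f x - ∫ y, f y ∂gaussMat M N) ^ 2 ∂gaussMat M N) / δ ^ 2) := by
  obtain ⟨hae, hmap⟩ := hA.map_eq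
  have hL : MemLp f 2 (gaussMat M N) := memLp_lipschitz hf (by norm_num)
  have h := meas_ge_le_variance_div_sq hL hδ
  rw [variance_eq_integral hL.aestronglyMeasurable.aemeasurable] at h
  refine le_trans ?_ h
  set c := ∫ x, f x ∂gaussMat M N with hc
  have hT : MeasurableSet {x : Fin M → Fin N → ℝ | δ ≤ |f x - c|} :=
    measurableSet_le measurable_const
      ((hf.continuous.measurable.sub_const c).abs)
  rw [← hmap, Measure.map_apply_of_aemeasurable hae hT]
  exact measure_mono fun ω hω => hS ω hω

end RandomFeasibility

end

/-! ### Assembly of the sharp threshold -/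

theorem mainTheorem5 (q : ℝ≥0∞) (hq : 2 < q) (α : ℝ) (hα : 0 < α)
    (M : ℕ → ℕ) (hM : Tendsto (fun N : ℕ => (M N : ℝ) / (N : ℝ)) atTop (𝓝 α))
    (Q : ∀ N : ℕ, Set (EuclideanSpace ℝ (Fin N)))
    (hQ : ∀ N, Q N ⊆ Metric.closedBall 0 1) (hQne : ∀ N, (Q N).Nonempty)
    (E : ∀ N : ℕ, Set (Fin (M N) → ℝ))
    (hE : ∀ N, RandomFeasibility.PermutationSymmetric (E N)) (hEne : ∀ N, (E N).Nonempty) :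
    ∃ Kc : ℕ → ℝ,
      ∀ (Ω : ℕ → Type*) [∀ N, MeasurableSpace (Ω N)] (P : ∀ N, Measure (Ω N))
        [∀ N, IsProbabilityMeasure (P N)] (A : ∀ N, Ω N → Matrix (Fin (M N)) (Fin N) ℝ),
        (∀ N, RandomFeasibility.HasIndepStdNormalEntries (A N) (P N)) →
      ∀ ε : ℝ, 0 < ε → ∀ K : ℕ → ℝ,
        ((∀ᶠ N in atTop, K N < Kc N - ε) →
          RandomFeasibility.WithHighProbability P (fun N => {ω |
            RandomFeasibility.margin q (Q N)
                (RandomFeasibility.expansion q (E N) (K N)) (A N ω) ≠ 0 ∧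
            ¬ RandomFeasibility.HasSolution (Q N)
                (RandomFeasibility.expansion q (E N) (K N)) (A N ω)})) ∧
        ((∀ᶠ N in atTop, Kc N + ε < K N) →
          RandomFeasibility.WithHighProbability P (fun N => {ω |
            RandomFeasibility.margin q (Q N)
                (RandomFeasibility.expansion q (E N) (K N)) (A N ω) = 0 ∧
            RandomFeasibility.HasSolution (Q N)
                (RandomFeasibility.expansion q (E N) (K N)) (A N ω)})) := by
  have : Fact (1 ≤ q) := ⟨le_trans (by norm_num) hq.le⟩
  -- The exponent is `min(q, 4)`: the variance bound covers only `(2, 4]`, and a Lipschitz bound in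
  -- a smaller exponent is weaker but sufficient.
  obtain ⟨p, hp2, hp4, hpq⟩ : ∃ p : ℝ, 2 < p ∧ p ≤ 4 ∧ ENNReal.ofReal p ≤ q := by
    by_cases h4 : 4 ≤ q
    · exact ⟨4, by norm_num, le_rfl, by simpa using h4⟩
    · have hqt : q ≠ ∞ := fun h => h4 (h ▸ le_top)
      refine ⟨q.toReal, ?_, ?_, ENNReal.ofReal_toReal_le⟩
      · have := (ENNReal.toReal_lt_toReal (by norm_num) hqt).2 hq
        simpa using this
      · have := (ENNReal.toReal_le_toReal hqt (by norm_num)).2 (not_le.1 h4).le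
        simpa using this
  have hp0 : 0 < p := by linarith
  have hMtop : Tendsto M atTop atTop := by
    have h1 : Tendsto (fun N : ℕ => (M N : ℝ) / N * N) atTop atTop :=
      hM.pos_mul_atTop hα tendsto_natCast_atTop_atTop
    rw [← tendsto_natCast_atTop_iff (R := ℝ)]
    refine h1.congr' ?_
    filter_upwards [eventually_gt_atTop 0] with N hN
    have : (N : ℝ) ≠ 0 := Nat.cast_ne_zero.2 hN.ne'
    field_simp
  set f : ∀ N : ℕ, (Fin (M N) → Fin N → ℝ) → ℝ := fun N A =>
    (RandomFeasibility.margin q (Q N) (E N) (Matrix.of A)).toReal with hf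
  have hfL : ∀ N, RandomFeasibility.MixedLipschitz p (f N) := fun N =>
    RandomFeasibility.mixedLipschitz_margin hp0 hpq (hQ N) (hQne N) (hEne N)
  have hfS : ∀ N, RandomFeasibility.RowSymmetric (f N) := fun N =>
    RandomFeasibility.rowSymmetric_margin (hE N)
  -- The threshold is the Gaussian mean of the margin, fixed before any probability space is chosen.
  set Kc : ℕ → ℝ := fun N => ∫ x, f N x ∂ RandomFeasibility.gaussMat (M N) N with hKc
  set V : ℕ → ℝ := fun N => ∫ x, (f N x - Kc N) ^ 2 ∂ RandomFeasibility.gaussMat (M N) N with hV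
  have hVlim : Tendsto V atTop (𝓝 0) := by
    refine tendsto_order.2 ⟨fun a ha => Eventually.of_forall fun N =>
      ha.trans_le (integral_nonneg fun x => sq_nonneg _), fun a ha => ?_⟩
    obtain ⟨M₀, hM₀⟩ := RandomFeasibility.exists_variance_le hp2 hp4 (half_pos ha)
    filter_upwards [hMtop.eventually_ge_atTop M₀] with N hN
    exact (hM₀ (M N) hN N (f N) (hfL N) (hfS N)).trans_lt (half_lt_self ha)
  refine ⟨Kc, ?_⟩
  intro Ω _ P _ A hA ε hε K
  have hlim : Tendsto (fun N => ENNReal.ofReal (V N / ε ^ 2)) atTop (𝓝 0) := by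
    have h1 := ENNReal.tendsto_ofReal (hVlim.div_const (ε ^ 2))
    rwa [zero_div, ENNReal.ofReal_zero] at h1
  -- Any event implied by the margin lying within `ε` of its mean holds with high probability.
  have hwhp : ∀ S : ∀ N, Set (Ω N),
      (∀ᶠ N in atTop, ∀ ω, |f N (fun i j => A N ω i j) - Kc N| < ε → ω ∈ S N) →
      RandomFeasibility.WithHighProbability P S := by
    intro S hS
    refine tendsto_of_tendsto_of_tendsto_of_le_of_le' tendsto_const_nhds hlim
      (Eventually.of_forall fun N => zero_le) ?_
    filter_upwards [hS] with N hN
    refine (hA N).measure_le ((hfL N).lipschitzWith hp0) hε fun ω hω => ?_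
    by_contra hcon
    exact hω (hN ω (not_le.1 hcon))
  constructor
  · intro hK
    refine hwhp _ ?_
    filter_upwards [hK] with N hN ω hω
    refine RandomFeasibility.unsatisfiable_of_lt_margin ?_
    have := (abs_lt.1 hω).1
    change K N < f N (fun i j => A N ω i j)
    linarith
  · intro hK
    refine hwhp _ ?_
    filter_upwards [hK] with N hN ω hω
    refine RandomFeasibility.satisfiable_of_margin_lt
      (RandomFeasibility.margin_ne_top (hQne N) (hEne N) _) ?_
    have := (abs_lt.1 hω).2
    change f N (fun i j => A N ω i j) < K N
    linarith
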